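/- Theorem (Compressed-SSC under deterministic noise). \label{thm_main_noisy} Setting. Let $\mathcal U^{(1)},\dots,\mathcal U^{(k)}\subseteq\mathbb R^d$ be linear subspaces, and let $\mathbf X=\mathbf Y+\mathbf Z\in\mathbb R^{d\times N}$, where each column $y_i$ of $\mathbf Y$ has unit Euclidean norm and lies in the subspace $\mathcal U^{(\ell)}$ of its cluster $\ell$, and the noise columns $z_i$ are arbitrary with $\max_i\|z_i\|_2\le\eta$. Write $\mathbf X^{(\ell)}$, $\mathbf Y^{(\ell)}$ for the columns of the $\ell$-th cluster, and let the subscript $-i$ mean that the $i$-th column is left out. Let $\lambda>0$. Geometric quantities. For a column $x_i$ of the $\ell$-th cluster, let $\nu(x_i)$ be the unique maximizer of $\langle x_i,\nu\rangle-\frac{\lambda}{2}\nu^\top\nu$ over $\nu\in\mathbb R^d$ subject to $\|(\mathbf X^{(\ell)}_{-i})^\top\nu\|_\infty\le 1$, and let $v(x_i)=\mathcal P_{\mathcal U^{(\ell)}}\nu(x_i)/\|\mathcal P_{\mathcal U^{(\ell)}}\nu(x_i)\|_2$. The subspace incoherence is $$\mu_\ell=\max\{|\langle v(x_i),x_j\rangle|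 : x_i \text{ in cluster } \ell,\ x_j\text{ not in cluster }\ell\}$$ (with value $0$ if there is only one cluster). The inradius is $\rho_\ell=\min_i r(\mathcal Q(\mathbf Y^{(\ell)}_{-i}))$, over the points $i$ of cluster $\ell$, where $\mathcal Q(\mathbf A)$ is the convex hull of the columns of $\mathbf A$ and their negatives, and $r(\cdot)$ is the radius of the largest ball of the subspace $\mathcal U^{(\ell)}$ contained in that set. Put $\rho=\min_\ell\rho_\ell$ and $\Delta=\min_\ell(\rho_\ell-\mu_\ell)$. Compression. A matrix $\mathbf\Psi\in\mathbb R^{p\times d}$ is $\epsilon$-well-behaved if $|\langle x,y\rangle-\langle\mathbf\Psi x,\mathbf\Psi y\rangle|\le\epsilon\,\frac{\|x\|^2+\|y\|^2}{2}$ for all $\ell,\ell'$ and all $x,y\in\mathcal U^{(\ell)}\cup\mathcal U^{(\ell')}$, and $(1-\epsilon)\|x\|_2^2\le\|\mathbf\Psi x\|_2^2\le(1+\epsilon)\|x\|_2^2$ for all $x\in\{x_1,z_1,\dots,x_N,z_N\}$. The compressed data are $\widetilde{\mathbf X}'=\widetilde{\mathbf Y}'+\widetilde{\mathbf Z}$,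 where $\widetilde{\mathbf Y}'$ has the columns $\mathbf\Psi y_i/\|\mathbf\Psi y_i\|_2$ and $\widetilde{\mathbf Z}=\mathbf\Psi\mathbf Z$. Lasso SSC on $\widetilde{\mathbf X}'$ returns, for each $i$, a minimizer $c_i\in\mathbb R^N$ of $\|\tilde x'_i-\widetilde{\mathbf X}'c\|_2^2+2\lambda\|c\|_1$ subject to $c_{ii}=0$. It has the subspace detection property if such minimizers exist and, for every choice of them and every $i$, $c_i\ne 0$, and $c_{ij}\neq0$ only if $i$ and $j$ belong to the same cluster. Claim. There is a universal constant $c>0$ (independent of $d,p,N,k$, the subspaces, the data, $\mathbf\Psi$, $\epsilon$, $\eta$, $\lambda$) such that, if $\mu_\ell<\rho_\ell$ for all $\ell$, if $\mathbf\Psi$ is $\epsilon$-well-behaved, if $$\frac{24\eta}{\Delta}<\lambda<\rho(1-\epsilon)-6\eta,$$ and if $\max(\epsilon,\eta)\le c\,\Delta^2\lambda^{3/2}$, then Lasso SSC with parameter $\lambda$ on $\widetilde{\mathbf X}'$ has the subspace detection property. -/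

import Mathlib

open scoped RealInnerProductSpace

namespace CompressedSSC

/-- `ℝⁿ` with the Euclidean norm. -/
abbrev Vec (n : ℕ) : Type := EuclideanSpace ℝ (Fin n)

section Lasso

variable {n N : ℕ}

/-- The Lasso self-regression objective `‖xᵢ - X c‖₂² + 2 λ ‖c‖₁` for the `i`-th column. -/
noncomputable def lassoObjective (X : Fin N → Vec n) (lam : ℝ) (i : Fin N) (c : Fin N → ℝ) : ℝ :=
  ‖X i - ∑ j, c j • X j‖ ^ 2 + 2 * lam * ∑ j, |c j|

/-- `c` is an optimal solution of the Lasso problem of column `i`, with the constraint `cᵢ = 0`. -/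
def IsLassoSolution (X : Fin N → Vec n) (lam : ℝ) (i : Fin N) (c : Fin N → ℝ) : Prop :=
  c i = 0 ∧ ∀ c' : Fin N → ℝ, c' i = 0 → lassoObjective X lam i c ≤ lassoObjective X lam i c'

/-- `C` is an output of Lasso SSC: for each `i` the vector `C i` is a Lasso solution. -/
def IsLassoSSCOutput (X : Fin N → Vec n) (lam : ℝ) (C : Fin N → Fin N → ℝ) : Prop :=
  ∀ i, IsLassoSolution X lam i (C i)

/-- The subspace detection property of a similarity matrix, where `label i` is the cluster of the
`i`-th data point: each `C i` is non-trivial and has no false connection. -/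
def SubspaceDetection {k : ℕ} (label : Fin N → Fin k) (C : Fin N → Fin N → ℝ) : Prop :=
  ∀ i, C i ≠ 0 ∧ ∀ j, C i j ≠ 0 → label i = label j

/-- Lasso SSC on `X` has the subspace detection property: the Lasso problems are solvable, and the
property holds whichever optimal solutions are returned. -/
def LassoSSCDetects {k : ℕ} (X : Fin N → Vec n) (label : Fin N → Fin k) (lam : ℝ) : Prop :=
  (∃ C, IsLassoSSCOutput X lam C) ∧
    ∀ C, IsLassoSSCOutput X lam C → SubspaceDetection label C

end Lasso

section Dual

variable {n : ℕ} {ι : Type*}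

/-- `ν` maximizes `⟪x, ν⟫ - (λ/2) ⟪ν, ν⟫` subject to `‖Aᵀ ν‖_∞ ≤ 1`, where the `A j` are the
columns of the matrix `A`. -/
def IsDualDirection (lam : ℝ) (x : Vec n) (A : ι → Vec n) (ν : Vec n) : Prop :=
  (∀ j, |⟪A j, ν⟫| ≤ 1) ∧
    ∀ ν' : Vec n, (∀ j, |⟪A j, ν'⟫| ≤ 1) →
      ⟪x, ν'⟫ - lam / 2 * ⟪ν', ν'⟫ ≤ ⟪x, ν⟫ - lam / 2 * ⟪ν, ν⟫

theorem existsUnique_isDualDirection {lam : ℝ} (hlam : 0 < lam) (x : Vec n) (A : ι → Vec n) :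
    ∃! ν, IsDualDirection lam x A ν := by
  set K : Set (Vec n) := {ν | ∀ j, |⟪A j, ν⟫| ≤ 1} with hK
  have hconv : Convex ℝ K := by
    intro a ha b hb s t hs ht hst j
    have h1 := abs_le.1 (ha j)
    have h2 := abs_le.1 (hb j)
    rw [inner_add_right, inner_smul_right, inner_smul_right, abs_le]
    constructor <;> nlinarith
  have hclosed : IsClosed K := by
    have : K = ⋂ j, {ν | |⟪A j, ν⟫| ≤ 1} := by ext; simp [hK]
    rw [this]
    exact isClosed_iInter fun j => isClosed_le (by fun_prop) continuous_const
  have hne : K.Nonempty := ⟨0, fun j => by simp⟩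
  have hsq : ∀ ν : Vec n, ⟪x, ν⟫ - lam / 2 * ⟪ν, ν⟫
      = 1 / (2 * lam) * ‖x‖ ^ 2 - lam / 2 * ‖lam⁻¹ • x - ν‖ ^ 2 := by
    intro ν
    rw [@norm_sub_sq_real, real_inner_self_eq_norm_sq, norm_smul, inner_smul_left, mul_pow,
      Real.norm_eq_abs, sq_abs]
    simp only [RCLike.conj_to_real]
    field_simp
    ring
  obtain ⟨ν, hν, hmin⟩ :=
    exists_norm_eq_iInf_of_complete_convex hne hclosed.isComplete hconv (lam⁻¹ • x)
  have hle : ∀ w ∈ K, ‖lam⁻¹ • x - ν‖ ≤ ‖lam⁻¹ • x - w‖ := by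
    intro w hw
    rw [hmin]
    exact ciInf_le ⟨0, by rintro _ ⟨w, rfl⟩; exact norm_nonneg _⟩ (⟨w, hw⟩ : K)
  refine ⟨ν, ⟨hν, fun w hw => ?_⟩, ?_⟩
  · rw [hsq, hsq]
    have := pow_le_pow_left₀ (norm_nonneg _) (hle w hw) 2
    nlinarith
  · rintro w ⟨hw, hwmax⟩
    have hin := (norm_eq_iInf_iff_real_inner_le_zero hconv hν).1 hmin w hw
    have h1 := hwmax ν hν
    rw [hsq, hsq] at h1
    have h2 : ‖lam⁻¹ • x - w‖ ^ 2 ≤ ‖lam⁻¹ • x - ν‖ ^ 2 := by nlinarith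
    have h3 : lam⁻¹ • x - w = (lam⁻¹ • x - ν) - (w - ν) := by abel
    rw [h3, @norm_sub_sq_real] at h2
    have h4 : ‖w - ν‖ ^ 2 ≤ 0 := by linarith
    have h5 : ‖w - ν‖ = 0 := by
      have := sq_nonneg ‖w - ν‖
      exact pow_eq_zero_iff (two_ne_zero) |>.1 (le_antisymm h4 this)
    exact sub_eq_zero.1 (norm_eq_zero.1 h5)

open Classical in
/-- The dual direction, i.e. the solution of the dual problem. It exists and is unique for
`λ > 0`, by `existsUnique_isDualDirection`; the value for other `λ` is irrelevant. -/
noncomputable def dualDirection (lam : ℝ) (x : Vec n) (A : ι → Vec n) : Vec n :=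
  if h : ∃ ν, IsDualDirection lam x A ν then h.choose else 0

theorem dualDirection_spec {lam : ℝ} (hlam : 0 < lam) (x : Vec n) (A : ι → Vec n) :
    IsDualDirection lam x A (dualDirection lam x A) := by
  have h : ∃ ν, IsDualDirection lam x A ν := (existsUnique_isDualDirection hlam x A).exists
  rw [dualDirection, dif_pos h]
  exact h.choose_spec

/-- The symmetric convex hull `conv(±a₁, …, ±a_N)` of the columns of `A`. -/
def symmHull (A : ι → Vec n) : Set (Vec n) :=
  convexHull ℝ (Set.range A ∪ Set.range fun j => -A j)

/-- The radius of the largest ball of the subspace `U` that is inscribed in `Q ⊆ U`. -/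
noncomputable def inradius (U : Submodule ℝ (Vec n)) (Q : Set (Vec n)) : ℝ :=
  sSup {r : ℝ | 0 ≤ r ∧ ∃ c ∈ U, Metric.closedBall c r ∩ (U : Set (Vec n)) ⊆ Q}

end Dual

section Geometry

variable {d N k : ℕ}

/-- The columns of the `label i`-th cluster, the `i`-th column left out. -/
def clusterWithout (X : Fin N → Vec d) (label : Fin N → Fin k) (i : Fin N) :
    {j : Fin N // label j = label i ∧ j ≠ i} → Vec d :=
  fun j => X j

/-- The normalized projected dual direction `v(xᵢ) = P ν(xᵢ) / ‖P ν(xᵢ)‖`, where `P` is the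
orthogonal projection onto the subspace of `xᵢ`, and `ν(xᵢ)` is the dual direction of `xᵢ` with
respect to the other columns of its cluster. -/
noncomputable def projectedDual (U : Fin k → Submodule ℝ (Vec d)) (label : Fin N → Fin k)
    (lam : ℝ) (X : Fin N → Vec d) (i : Fin N) : Vec d :=
  let w := (U (label i)).starProjection (dualDirection lam (X i) (clusterWithout X label i))
  ‖w‖⁻¹ • w

/-- Subspace incoherence `μ_ℓ` of the (noisy) data `X`: the maximum of `|⟪v(xᵢ), xⱼ⟫|` over `xᵢ` in
the `ℓ`-th cluster and `xⱼ` outside of it (`0` if there is only one cluster). -/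
noncomputable def incoherence (U : Fin k → Submodule ℝ (Vec d)) (label : Fin N → Fin k)
    (lam : ℝ) (X : Fin N → Vec d) (l : Fin k) : ℝ :=
  ⨆ i : {i : Fin N // label i = l}, ⨆ j : {j : Fin N // label j ≠ l},
    |⟪projectedDual U label lam X i, X j⟫|

/-- Inradius `ρ_ℓ` of the uncorrupted data `Y`: the minimum over the points `i` of the `ℓ`-th
cluster of the inradius of the symmetric convex hull of the other points of that cluster. -/
noncomputable def clusterInradius (U : Fin k → Submodule ℝ (Vec d)) (label : Fin N → Fin k)
    (Y : Fin N → Vec d) (l : Fin k) : ℝ :=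
  ⨅ i : {i : Fin N // label i = l}, inradius (U l) (symmHull (clusterWithout Y label i))

/-- `ρ = min_ℓ ρ_ℓ`. -/
noncomputable def minInradius (U : Fin k → Submodule ℝ (Vec d)) (label : Fin N → Fin k)
    (Y : Fin N → Vec d) : ℝ :=
  ⨅ l, clusterInradius U label Y l

/-- The geometric gap `Δ = min_ℓ (ρ_ℓ - μ_ℓ)` for the noisy data `X = Y + Z`. -/
noncomputable def gap (U : Fin k → Submodule ℝ (Vec d)) (label : Fin N → Fin k)
    (lam : ℝ) (Y Z : Fin N → Vec d) : ℝ :=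
  ⨅ l, (clusterInradius U label Y l - incoherence U label lam (Y + Z) l)

/-- `Ψ` is `ε`-well-behaved: it approximately preserves inner products on each pair of subspaces,
and the norms of the observed points and of the noise vectors. -/
structure WellBehaved {p : ℕ} (Ψ : Vec d →ₗ[ℝ] Vec p) (U : Fin k → Submodule ℝ (Vec d))
    (X Z : Fin N → Vec d) (ε : ℝ) : Prop where
  inner_approx : ∀ l l' : Fin k, ∀ x ∈ (U l : Set (Vec d)) ∪ U l', ∀ y ∈ (U l : Set (Vec d)) ∪ U l',
    |⟪x, y⟫ - ⟪Ψ x, Ψ y⟫| ≤ ε * ((‖x‖ ^ 2 + ‖y‖ ^ 2) / 2)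
  norm_data : ∀ i, (1 - ε) * ‖X i‖ ^ 2 ≤ ‖Ψ (X i)‖ ^ 2 ∧ ‖Ψ (X i)‖ ^ 2 ≤ (1 + ε) * ‖X i‖ ^ 2
  norm_noise : ∀ i, (1 - ε) * ‖Z i‖ ^ 2 ≤ ‖Ψ (Z i)‖ ^ 2 ∧ ‖Ψ (Z i)‖ ^ 2 ≤ (1 + ε) * ‖Z i‖ ^ 2

/-- The compressed data: the projected uncorrupted columns `Ψ yᵢ` are scaled to unit norm, and the
projected noise `Ψ zᵢ` is added. -/
noncomputable def compressed {p : ℕ} (Ψ : Vec d →ₗ[ℝ] Vec p) (Y Z : Fin N → Vec d) :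
    Fin N → Vec p :=
  fun i => ‖Ψ (Y i)‖⁻¹ • Ψ (Y i) + Ψ (Z i)

end Geometry

end CompressedSSC

/-!
A Lasso solution vanishes off the cluster of its target `i` as soon as the dual direction of the
Lasso problem restricted to that cluster has inner product of modulus less than `1` with every data
point outside the cluster. This dual direction is stable: inside `ℝᵖ` split it as `Ψ w + q` with
`w ∈ U` and `q ⟂ Ψ U`. Since the compressed columns are nearly images of points of `U`, and the dual
problem is strongly concave, `q` is negligible and `w` is close to the dual direction `ν₀` of the
noiseless problem; the inradius bounds `w` itself. The uncompressed noisy problem is the special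
case `Ψ = id`, so the dual direction in the definition of the incoherence is also close to `ν₀`,
and the gap between inradius and incoherence absorbs all the errors.

The zero vector is not a solution: otherwise the correlations of the target with its cluster are at
most about `λ`, whereas some correlation is at least the inradius.
-/

namespace CompressedSSC

section InnerProduct

variable {E F : Type*} [NormedAddCommGroup E] [InnerProductSpace ℝ E]
  [NormedAddCommGroup F] [InnerProductSpace ℝ F]

theorem convex_setOf_abs_le (f : E →ₗ[ℝ] ℝ) (M : ℝ) : Convex ℝ {q : E | |f q| ≤ M} := by
  have hpre : {q : E | |f q| ≤ M} = f ⁻¹' Set.Icc (-M) M := by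
    ext q
    simp [abs_le]
  rw [hpre]
  exact (convex_Icc (-M) M).linear_preimage f

theorem abs_inner_inv_smul_le_one {a b : E} {m : ℝ} (hm : 0 < m) (h : |⟪a, b⟫| ≤ m) :
    |⟪a, m⁻¹ • b⟫| ≤ 1 := by
  rwa [real_inner_smul_right, abs_mul, abs_of_pos (inv_pos.2 hm), inv_mul_le_iff₀ hm, mul_one]

theorem abs_inner_le_abs_inner_add_add {u v z x : E} {h : ℝ} (hu : ‖u‖ ≤ 1) (hv : ‖v‖ ≤ 1)
    (hz : ‖z‖ ≤ h) (hx : ‖x‖ ≤ h) : |⟪u, v⟫| ≤ |⟪u + z, v + x⟫| + 2 * h + h ^ 2 := by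
  have bound {a b : E} {r s : ℝ} (ha : ‖a‖ ≤ r) (hb : ‖b‖ ≤ s) : |⟪a, b⟫| ≤ r * s :=
    (abs_real_inner_le_norm a b).trans
      (mul_le_mul ha hb (norm_nonneg _) ((norm_nonneg _).trans ha))
  have hsplit : ⟪u, v⟫ = ⟪u + z, v + x⟫ - (⟪u, x⟫ + ⟪z, v⟫ + ⟪z, x⟫) := by
    simp only [inner_add_left, inner_add_right]
    ring
  calc |⟪u, v⟫| ≤ |⟪u + z, v + x⟫| + |⟪u, x⟫ + ⟪z, v⟫ + ⟪z, x⟫| := hsplit ▸ abs_sub _ _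
    _ ≤ |⟪u + z, v + x⟫| + (1 * h + h * 1 + h * h) := by
        gcongr
        exact (abs_add_three _ _ _).trans
          (add_le_add (add_le_add (bound hu hx) (bound hz hv)) (bound hz hx))
    _ = |⟪u + z, v + x⟫| + 2 * h + h ^ 2 := by ring

theorem abs_inner_le_norm_sub_add_mul {y z v w : E} {h μ : ℝ} (hy : ‖y‖ ≤ 1) (hz : ‖z‖ ≤ h)
    (hv : |⟪y + z, v⟫| ≤ μ * ‖v‖) : |⟪y, w⟫| ≤ ‖w - v‖ + (μ + h) * ‖v‖ := by
  have hsplit : ⟪y, w⟫ = ⟪y, w - v⟫ + (⟪y + z, v⟫ - ⟪z, v⟫) := by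
    rw [inner_sub_right, inner_add_left]
    ring
  have hdist : |⟪y, w - v⟫| ≤ 1 * ‖w - v‖ := (abs_real_inner_le_norm _ _).trans (by gcongr)
  have hnoise : |⟪z, v⟫| ≤ h * ‖v‖ := (abs_real_inner_le_norm _ _).trans (by gcongr)
  rw [hsplit]
  linarith [abs_add_le ⟪y, w - v⟫ (⟪y + z, v⟫ - ⟪z, v⟫), abs_sub ⟪y + z, v⟫ ⟪z, v⟫]

theorem norm_inv_norm_smul_le_one (a : E) : ‖‖a‖⁻¹ • a‖ ≤ 1 := by
  rw [norm_smul, norm_inv, norm_norm]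
  exact inv_mul_le_one

theorem norm_inv_norm_smul_sub_self_le (a : E) : ‖‖a‖⁻¹ • a - a‖ ≤ |1 - ‖a‖ ^ 2| := by
  rcases eq_or_ne a 0 with rfl | ha
  · simp
  have hnorm : ‖‖a‖⁻¹ • a - a‖ = |1 - ‖a‖| := by
    rw [show ‖a‖⁻¹ • a - a = (‖a‖⁻¹ - 1) • a by rw [sub_smul, one_smul], norm_smul,
      Real.norm_eq_abs, ← abs_norm a, ← abs_mul, abs_norm, sub_mul,
      inv_mul_cancel₀ (norm_ne_zero_iff.2 ha), one_mul]
  have hfactor : 1 - ‖a‖ ^ 2 = (1 - ‖a‖) * (1 + ‖a‖) := by ring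
  rw [hnorm, hfactor, abs_mul]
  refine le_mul_of_one_le_right (abs_nonneg _) ?_
  rw [abs_of_nonneg (by positivity)]
  linarith [norm_nonneg a]

/-- `Ψ` preserves the inner products between `S` and `T` up to the relative error `δ`. This is the
homogeneous form of the first condition of `WellBehaved`. -/
def NearlyPreservesInner (Ψ : E →ₗ[ℝ] F) (δ : ℝ) (S T : Submodule ℝ E) : Prop :=
  ∀ x ∈ S, ∀ y ∈ T, |⟪x, y⟫ - ⟪Ψ x, Ψ y⟫| ≤ δ * ‖x‖ * ‖y‖

namespace NearlyPreservesInner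

variable {Ψ : E →ₗ[ℝ] F} {δ : ℝ} {S T : Submodule ℝ E}

theorem mono {δ' : ℝ} (h : NearlyPreservesInner Ψ δ S T) (hδ : δ ≤ δ') :
    NearlyPreservesInner Ψ δ' S T :=
  fun x hx y hy => (h x hx y hy).trans (by gcongr)

theorem abs_sq_norm_sub_le (h : NearlyPreservesInner Ψ δ S S) {x : E} (hx : x ∈ S) :
    |‖x‖ ^ 2 - ‖Ψ x‖ ^ 2| ≤ δ * ‖x‖ ^ 2 := by
  simpa only [real_inner_self_eq_norm_sq, mul_assoc, ← sq] using h x hx x hx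

theorem nonneg (h : NearlyPreservesInner Ψ δ S S) {x : E} (hx : x ∈ S) (hx1 : ‖x‖ = 1) : 0 ≤ δ := by
  simpa [hx1] using (abs_nonneg _).trans (h.abs_sq_norm_sub_le hx)

theorem norm_map_le_two_mul (h : NearlyPreservesInner Ψ δ S S) (hδ : δ ≤ 3) {x : E} (hx : x ∈ S) :
    ‖Ψ x‖ ≤ 2 * ‖x‖ := by
  refine le_of_sq_le_sq ?_ (by positivity)
  have hlower := (abs_le.1 (h.abs_sq_norm_sub_le hx)).1
  nlinarith [mul_le_mul_of_nonneg_right hδ (sq_nonneg ‖x‖)]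

theorem abs_inner_map_sub_inner_le (hST : NearlyPreservesInner Ψ δ S T)
    (hTT : NearlyPreservesInner Ψ δ T T) (hδ : δ ≤ 3) {y u : E} {b : F} {τ : ℝ} (hy : y ∈ S)
    (hy1 : ‖y‖ = 1) (hu : u ∈ T) (hb : ‖b - Ψ y‖ ≤ τ) :
    |⟪b, Ψ u⟫ - ⟪y, u⟫| ≤ (2 * τ + δ) * ‖u‖ := by
  have hsplit : ⟪b, Ψ u⟫ - ⟪y, u⟫ = ⟪b - Ψ y, Ψ u⟫ - (⟪y, u⟫ - ⟪Ψ y, Ψ u⟫) := by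
    rw [inner_sub_left]
    ring
  have hτ : 0 ≤ τ := (norm_nonneg _).trans hb
  calc |⟪b, Ψ u⟫ - ⟪y, u⟫| ≤ |⟪b - Ψ y, Ψ u⟫| + |⟪y, u⟫ - ⟪Ψ y, Ψ u⟫| := hsplit ▸ abs_sub _ _
    _ ≤ τ * (2 * ‖u‖) + δ * ‖y‖ * ‖u‖ := by
        refine add_le_add ((abs_real_inner_le_norm _ _).trans ?_) (hST y hy u hu)
        gcongr
        exact hTT.norm_map_le_two_mul hδ hu
    _ = (2 * τ + δ) * ‖u‖ := by
        rw [hy1]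
        ring

theorem sq_norm_sub_sub_le (h : NearlyPreservesInner Ψ δ S S) (hδ : 0 ≤ δ) {w v : E} {q : F}
    {K : ℝ} (hw : w ∈ S) (hv : v ∈ S) (hq : q ∈ (S.map Ψ)ᗮ) (hwK : ‖w‖ ≤ K) (hvK : ‖v‖ ≤ K) :
    ‖w - v‖ ^ 2 - 2 * δ * K ^ 2
      ≤ ⟪v, v⟫ + ⟪Ψ w + q, Ψ w + q⟫ - ⟪v, w⟫ - ⟪Ψ w + q, Ψ v⟫ := by
  have hwq : ⟪Ψ w, q⟫ = 0 :=
    Submodule.inner_right_of_mem_orthogonal (Submodule.mem_map_of_mem hw) hq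
  have hqv : ⟪q, Ψ v⟫ = 0 :=
    Submodule.inner_left_of_mem_orthogonal (Submodule.mem_map_of_mem hv) hq
  have hsq := (abs_le.1 (h.abs_sq_norm_sub_le hw)).2
  have hcross := (abs_le.1 (h w hw v hv)).1
  have hK : 0 ≤ K := (norm_nonneg w).trans hwK
  have hsqK : δ * ‖w‖ ^ 2 ≤ δ * K ^ 2 := by gcongr
  have hcrossK : δ * ‖w‖ * ‖v‖ ≤ δ * K ^ 2 := by
    rw [mul_assoc, sq]
    gcongr
  rw [real_inner_add_add_self, inner_add_left, hwq, hqv, norm_sub_sq_real, real_inner_comm w v,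
    real_inner_self_eq_norm_sq, real_inner_self_eq_norm_sq, real_inner_self_eq_norm_sq]
  linarith [sq_nonneg ‖q‖]

end NearlyPreservesInner

/-- `b` is the image of `y` under `Ψ` up to an error `δ`, as far as the functionals `⟪y, ·⟫` on `U`
and `⟪b, ·⟫` on the codomain are concerned: the latter is the former transported to `Ψ U`, extended
by zero to the orthogonal complement of `Ψ U`. -/
def IsApproxImage (Ψ : E →ₗ[ℝ] F) (U : Submodule ℝ E) (δ : ℝ) (y : E) (b : F) : Prop :=
  ∀ u ∈ U, ∀ q ∈ (U.map Ψ)ᗮ, |⟪b, Ψ u + q⟫ - ⟪y, u⟫| ≤ δ * (‖u‖ + ‖q‖)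

namespace IsApproxImage

variable {Ψ : E →ₗ[ℝ] F} {U : Submodule ℝ E} {δ : ℝ} {y : E} {b : F}

theorem abs_inner_map_sub_inner_le (h : IsApproxImage Ψ U δ y b) {u : E} (hu : u ∈ U) :
    |⟪b, Ψ u⟫ - ⟪y, u⟫| ≤ δ * ‖u‖ := by
  simpa using h u hu 0 (Submodule.zero_mem _)

theorem abs_inner_orthogonal_le (h : IsApproxImage Ψ U δ y b) {q : F} (hq : q ∈ (U.map Ψ)ᗮ) :
    |⟪b, q⟫| ≤ δ * ‖q‖ := by
  simpa using h 0 U.zero_mem q hq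

end IsApproxImage

theorem isApproxImage_of_norm_sub_le {Ψ : E →ₗ[ℝ] F} {U : Submodule ℝ E} {δ τ : ℝ} {y : E} {b : F}
    (hΨ : NearlyPreservesInner Ψ δ U U) (hδ0 : 0 ≤ δ) (hδ : δ ≤ 3) (hy : y ∈ U) (hy1 : ‖y‖ = 1)
    (hb : ‖b - Ψ y‖ ≤ τ) : IsApproxImage Ψ U (2 * τ + δ) y b := by
  intro u hu q hq
  have hτ : 0 ≤ τ := (norm_nonneg _).trans hb
  have horth : ⟪b, q⟫ = ⟪b - Ψ y, q⟫ := by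
    rw [inner_sub_left, Submodule.inner_right_of_mem_orthogonal (Submodule.mem_map_of_mem hy) hq,
      sub_zero]
  have hq_le : |⟪b, q⟫| ≤ τ * ‖q‖ := by
    rw [horth]
    exact (abs_real_inner_le_norm _ _).trans (by gcongr)
  calc |⟪b, Ψ u + q⟫ - ⟪y, u⟫| = |(⟪b, Ψ u⟫ - ⟪y, u⟫) + ⟪b, q⟫| := by
        rw [inner_add_right]
        congr 1
        ring
    _ ≤ (2 * τ + δ) * ‖u‖ + τ * ‖q‖ :=
        (abs_add_le _ _).trans
          (add_le_add (hΨ.abs_inner_map_sub_inner_le hΨ hδ hy hy1 hu hb) hq_le)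
    _ ≤ (2 * τ + δ) * (‖u‖ + ‖q‖) := by
        rw [mul_add]
        gcongr
        linarith

end InnerProduct

section DualDirection

variable {n : ℕ} {ι : Type*}

theorem nonpos_of_forall_mul_le_sq_mul {g B : ℝ}
    (h : ∀ τ : ℝ, 0 < τ → τ ≤ 1 → τ * g ≤ τ ^ 2 * B) : g ≤ 0 := by
  have hlim : Filter.Tendsto (fun τ : ℝ => τ * B) (nhdsWithin 0 (Set.Ioi 0)) (nhds 0) := by
    refine Filter.Tendsto.mono_left ?_ nhdsWithin_le_nhds
    simpa using (continuous_mul_const B).tendsto (0 : ℝ)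
  refine ge_of_tendsto hlim ?_
  filter_upwards [Ioc_mem_nhdsGT (zero_lt_one (α := ℝ))] with τ ⟨hτ0, hτ1⟩
  refine le_of_mul_le_mul_left ?_ hτ0
  rw [← mul_assoc, ← sq]
  exact h τ hτ0 hτ1

theorem dualObjective_add (lam : ℝ) (x ν z : Vec n) :
    ⟪x, ν + z⟫ - lam / 2 * ⟪ν + z, ν + z⟫
      = ⟪x, ν⟫ - lam / 2 * ⟪ν, ν⟫ + ⟪x - lam • ν, z⟫ - lam / 2 * ‖z‖ ^ 2 := by
  rw [real_inner_add_add_self, inner_add_right, inner_sub_left, real_inner_smul_left,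
    real_inner_self_eq_norm_sq z]
  ring

theorem isDualDirection_iff_inner_le {lam : ℝ} (hlam : 0 ≤ lam) {x : Vec n} {A : ι → Vec n}
    {ν : Vec n} :
    IsDualDirection lam x A ν ↔ (∀ j, |⟪A j, ν⟫| ≤ 1) ∧
      ∀ w, (∀ j, |⟪A j, w⟫| ≤ 1) → ⟪x - lam • ν, w⟫ ≤ ⟪x - lam • ν, ν⟫ := by
  refine and_congr_right fun hν => ⟨fun hmax w hw => ?_, fun hvar w hw => ?_⟩
  · refine sub_nonpos.1 (nonpos_of_forall_mul_le_sq_mul (B := lam / 2 * ‖w - ν‖ ^ 2) ?_)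
    intro τ hτ0 hτ1
    have hfeasible (j : ι) : |⟪A j, ν + τ • (w - ν)⟫| ≤ 1 :=
      (convex_setOf_abs_le (innerₗ _ (A j)) 1).add_smul_sub_mem (hν j) (hw j) ⟨hτ0.le, hτ1⟩
    have hle := hmax _ hfeasible
    rw [dualObjective_add, norm_smul, real_inner_smul_right, inner_sub_right, mul_pow,
      Real.norm_eq_abs, sq_abs] at hle
    linarith
  · have hobj := dualObjective_add lam x ν (w - ν)
    rw [add_sub_cancel, inner_sub_right] at hobj
    nlinarith [mul_nonneg hlam (sq_nonneg ‖w - ν‖), hvar w hw]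

namespace IsDualDirection

variable {lam : ℝ} {x ν : Vec n} {A : ι → Vec n}

theorem inner_sub_smul_nonneg (h : IsDualDirection lam x A ν) (hlam : 0 ≤ lam) :
    0 ≤ ⟪x - lam • ν, ν⟫ := by
  simpa using ((isDualDirection_iff_inner_le hlam).1 h).2 0 (by simp)

theorem inner_sub_smul_le_mul (h : IsDualDirection lam x A ν) (hlam : 0 ≤ lam) {w : Vec n} {m : ℝ}
    (hm : 0 < m) (hw : ∀ j, |⟪A j, w⟫| ≤ m) : ⟪x - lam • ν, w⟫ ≤ m * ⟪x - lam • ν, ν⟫ := by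
  have hle := ((isDualDirection_iff_inner_le hlam).1 h).2 (m⁻¹ • w)
    fun j => abs_inner_inv_smul_le_one hm (hw j)
  rwa [real_inner_smul_right, inv_mul_le_iff₀ hm] at hle

theorem mul_norm_le_of_inner_eq_zero {v q : Vec n} {δ : ℝ}
    (h : IsDualDirection lam x A (v + q)) (hlam : 0 ≤ lam) (hδ : 0 ≤ δ) (hvq : ⟪v, q⟫ = 0)
    (hx : |⟪x, q⟫| ≤ δ * ‖q‖) (hA : ∀ j, |⟪A j, q⟫| ≤ δ * ‖q‖) :
    lam * ‖q‖ ≤ δ * (1 + ⟪x - lam • (v + q), v + q⟫) := by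
  have hv (j : ι) : |⟪A j, v⟫| ≤ 1 + δ * ‖q‖ := by
    rw [← add_sub_cancel_right v q, inner_sub_right]
    exact (abs_sub _ _).trans (add_le_add (h.1 j) (hA j))
  have hvar := h.inner_sub_smul_le_mul hlam (by positivity) hv
  have hG := h.inner_sub_smul_nonneg hlam
  set G := ⟪x - lam • (v + q), v + q⟫ with hG_def
  have hsplit : G = ⟪x - lam • (v + q), v⟫ + (⟪x, q⟫ - lam * ‖q‖ ^ 2) := by
    rw [hG_def, inner_add_right, inner_sub_left x (lam • (v + q)) q, real_inner_smul_left,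
      inner_add_left v q q, hvq, zero_add, real_inner_self_eq_norm_sq]
  rcases (norm_nonneg q).eq_or_lt with hq | hq
  · rw [← hq, mul_zero]
    exact mul_nonneg hδ (by linarith)
  · refine le_of_mul_le_mul_right ?_ hq
    linarith [(abs_le.1 hx).2]

theorem mem_of_forall_mem (h : IsDualDirection lam x A ν) (hlam : 0 < lam)
    {U : Submodule ℝ (Vec n)} (hx : x ∈ U) (hA : ∀ j, A j ∈ U) : ν ∈ U := by
  have hq := U.sub_starProjection_mem_orthogonal ν
  have h' : IsDualDirection lam x A (U.starProjection ν + (ν - U.starProjection ν)) := by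
    rwa [add_sub_cancel]
  have hle := h'.mul_norm_le_of_inner_eq_zero hlam.le le_rfl
    (Submodule.inner_right_of_mem_orthogonal (U.starProjection_apply_mem ν) hq)
    (by rw [Submodule.inner_right_of_mem_orthogonal hx hq, abs_zero, zero_mul])
    (fun j => by rw [Submodule.inner_right_of_mem_orthogonal (hA j) hq, abs_zero, zero_mul])
  rw [zero_mul] at hle
  have hzero := norm_le_zero_iff.1 (nonpos_of_mul_nonpos_right hle hlam)
  rw [sub_eq_zero.1 hzero]
  exact U.starProjection_apply_mem ν

end IsDualDirection

theorem abs_le_of_mem_symmHull {A : ι → Vec n} {q : Vec n} {f : Vec n →ₗ[ℝ] ℝ} {M : ℝ}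
    (hA : ∀ j, |f (A j)| ≤ M) (hq : q ∈ symmHull A) : |f q| ≤ M := by
  refine convexHull_min ?_ (convex_setOf_abs_le f M) hq
  rintro _ (⟨j, rfl⟩ | ⟨j, rfl⟩)
  · exact hA j
  · simpa only [Set.mem_ofPred_eq, map_neg, abs_neg] using hA j

theorem inradius_nonneg (U : Submodule ℝ (Vec n)) (Q : Set (Vec n)) : 0 ≤ inradius U Q :=
  Real.sSup_nonneg fun _ hr => hr.1

theorem inradius_mul_apply_le {U : Submodule ℝ (Vec n)} {A : ι → Vec n} {u : Vec n}
    {f : Vec n →ₗ[ℝ] ℝ} {M : ℝ} (hu : u ∈ U) (hM : 0 ≤ M) (hA : ∀ j, |f (A j)| ≤ M) :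
    inradius U (symmHull A) * f u ≤ M * ‖u‖ := by
  rcases le_or_gt (f u) 0 with hfu | hfu
  · exact (mul_nonpos_of_nonneg_of_nonpos (inradius_nonneg U _) hfu).trans (by positivity)
  have hu0 : 0 < ‖u‖ := norm_pos_iff.2 fun h => hfu.ne' (by rw [h, map_zero])
  rw [← le_div_iff₀ hfu]
  refine Real.sSup_le ?_ (by positivity)
  rintro r ⟨hr, c, hc, hball⟩
  have hmem {t : ℝ} (ht : |t| ≤ r / ‖u‖) : |f (c + t • u)| ≤ M := by
    refine abs_le_of_mem_symmHull hA (hball ⟨?_, U.add_mem hc (U.smul_mem t hu)⟩)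
    rw [mem_closedBall_iff_norm, add_sub_cancel_left, norm_smul]
    exact (le_div_iff₀ hu0).1 ht
  have hr' : |r / ‖u‖| = r / ‖u‖ := abs_of_nonneg (by positivity)
  have hplus := (abs_le.1 (hmem hr'.le)).2
  have hminus := (abs_le.1 (hmem ((abs_neg _).trans hr').le)).1
  rw [map_add, map_smul, smul_eq_mul] at hplus hminus
  rw [le_div_iff₀ hfu, ← div_le_iff₀ hu0, mul_div_right_comm]
  linarith

theorem inradius_mul_norm_le {U : Submodule ℝ (Vec n)} {A : ι → Vec n} {w : Vec n} {M : ℝ}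
    (hw : w ∈ U) (hM : 0 ≤ M) (hA : ∀ j, |⟪A j, w⟫| ≤ M) :
    inradius U (symmHull A) * ‖w‖ ≤ M := by
  rcases eq_or_ne w 0 with rfl | hw0
  · simpa using hM
  refine le_of_mul_le_mul_right ?_ (norm_pos_iff.2 hw0)
  rw [mul_assoc, ← real_inner_self_eq_norm_mul_norm]
  exact inradius_mul_apply_le (f := innerₗ _ w) hw hM fun j => by
    simpa only [innerₗ_apply_apply, real_inner_comm] using hA j

end DualDirection

section Perturbation

variable {d p : ℕ} {ι : Type*} {Ψ : Vec d →ₗ[ℝ] Vec p} {U : Submodule ℝ (Vec d)} {δ : ℝ}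

/-- The data `(b, B)` of a dual problem in the codomain of `Ψ` are images, up to the error `δ`, of
the data `(y, A)` of a dual problem inside the subspace `U`. -/
structure IsDualPerturbation (Ψ : Vec d →ₗ[ℝ] Vec p) (U : Submodule ℝ (Vec d)) (δ : ℝ) (y : Vec d)
    (A : ι → Vec d) (b : Vec p) (B : ι → Vec p) : Prop where
  mem_target : y ∈ U
  mem_column : ∀ j, A j ∈ U
  norm_target_le_one : ‖y‖ ≤ 1
  nearlyPreservesInner : NearlyPreservesInner Ψ δ U U
  target : IsApproxImage Ψ U δ y b
  column : ∀ j, IsApproxImage Ψ U δ (A j) (B j)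

namespace IsDualPerturbation

variable {lam : ℝ} {y w ν₀ : Vec d} {A : ι → Vec d} {b q : Vec p} {B : ι → Vec p}

theorem inner_target_le_norm (h : IsDualPerturbation Ψ U δ y A b B) (u : Vec d) :
    ⟪y, u⟫ ≤ ‖u‖ :=
  (real_inner_le_norm y u).trans (mul_le_of_le_one_left (norm_nonneg u) h.norm_target_le_one)

theorem abs_inner_column_le (h : IsDualPerturbation Ψ U δ y A b B) (hw : w ∈ U)
    (hq : q ∈ (U.map Ψ)ᗮ) (hν : IsDualDirection lam b B (Ψ w + q)) (j : ι) :
    |⟪A j, w⟫| ≤ 1 + δ * (‖w‖ + ‖q‖) := by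
  have herror := h.column j w hw q hq
  rw [abs_sub_comm] at herror
  linarith [abs_sub_abs_le_abs_sub ⟪A j, w⟫ ⟪B j, Ψ w + q⟫, hν.1 j]

theorem abs_inner_column_map_le (h : IsDualPerturbation Ψ U δ y A b B) (hν₀ : ν₀ ∈ U)
    (hdual : IsDualDirection lam y A ν₀) (j : ι) : |⟪B j, Ψ ν₀⟫| ≤ 1 + δ * ‖ν₀‖ := by
  have herror := (h.column j).abs_inner_map_sub_inner_le hν₀
  linarith [abs_sub_abs_le_abs_sub ⟪B j, Ψ ν₀⟫ ⟪A j, ν₀⟫, hdual.1 j]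

theorem inner_sub_smul_le (h : IsDualPerturbation Ψ U δ y A b B) (hlam : 0 ≤ lam) (hw : w ∈ U)
    (hq : q ∈ (U.map Ψ)ᗮ) :
    ⟪b - lam • (Ψ w + q), Ψ w + q⟫ ≤ ‖w‖ + δ * (‖w‖ + ‖q‖) := by
  rw [inner_sub_left, real_inner_smul_left]
  linarith [(abs_le.1 (h.target w hw q hq)).2, h.inner_target_le_norm w,
    mul_nonneg hlam (real_inner_self_nonneg (x := Ψ w + q))]

theorem mul_norm_orthogonal_le (h : IsDualPerturbation Ψ U δ y A b B) (hlam : 0 ≤ lam)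
    (hδ : 0 ≤ δ) (hw : w ∈ U) (hq : q ∈ (U.map Ψ)ᗮ) (hν : IsDualDirection lam b B (Ψ w + q)) :
    lam * ‖q‖ ≤ δ * (1 + ‖w‖ + δ * (‖w‖ + ‖q‖)) := by
  have hwq : ⟪Ψ w, q⟫ = 0 :=
    Submodule.inner_right_of_mem_orthogonal (Submodule.mem_map_of_mem hw) hq
  refine (hν.mul_norm_le_of_inner_eq_zero hlam hδ hwq (h.target.abs_inner_orthogonal_le hq)
    fun j => (h.column j).abs_inner_orthogonal_le hq).trans ?_
  refine mul_le_mul_of_nonneg_left ?_ hδ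
  linarith [h.inner_sub_smul_le hlam hw hq]

theorem mul_sq_norm_sub_le (h : IsDualPerturbation Ψ U δ y A b B) (hlam : 0 ≤ lam) (hδ0 : 0 ≤ δ)
    (hδ1 : δ ≤ 1) {K : ℝ} (hν₀ : ν₀ ∈ U) (hdual : IsDualDirection lam y A ν₀) (hw : w ∈ U)
    (hq : q ∈ (U.map Ψ)ᗮ) (hν : IsDualDirection lam b B (Ψ w + q)) (hν₀K : ‖ν₀‖ ≤ K)
    (hνK : ‖w‖ + ‖q‖ ≤ K) :
    lam * ‖w - ν₀‖ ^ 2 ≤ δ * (2 * K + 3 * K ^ 2 + 2 * lam * K ^ 2) := by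
  have hwK : ‖w‖ ≤ K := by linarith [norm_nonneg q]
  have hK : 0 ≤ K := (norm_nonneg w).trans hwK
  have hδK : 0 ≤ δ * K := mul_nonneg hδ0 hK
  have hνδ : δ * (‖w‖ + ‖q‖) ≤ δ * K := by gcongr
  have hν₀δ : δ * ‖ν₀‖ ≤ δ * K := by gcongr
  -- Each dual direction competes, up to scaling, in the variational inequality of the other one.
  have hcompete := hdual.inner_sub_smul_le_mul hlam (m := 1 + δ * K) (by positivity)
    fun j => (h.abs_inner_column_le hw hq hν j).trans (by linarith)
  have hcompete' := hν.inner_sub_smul_le_mul hlam (m := 1 + δ * K) (by positivity)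
    fun j => (h.abs_inner_column_map_le hν₀ hdual j).trans (by linarith)
  have hG₀ : ⟪y - lam • ν₀, ν₀⟫ ≤ K := by
    rw [inner_sub_left, real_inner_smul_left]
    linarith [h.inner_target_le_norm ν₀, mul_nonneg hlam (real_inner_self_nonneg (x := ν₀))]
  have hG : ⟪b - lam • (Ψ w + q), Ψ w + q⟫ ≤ 2 * K := by
    linarith [h.inner_sub_smul_le hlam hw hq, mul_le_of_le_one_left hK hδ1]
  have hscale := mul_le_mul_of_nonneg_left (add_le_add hG₀ hG) hδK
  have hquad := mul_le_mul_of_nonneg_left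
    (h.nearlyPreservesInner.sq_norm_sub_sub_le hδ0 hw hν₀ hq hwK hν₀K) hlam
  have htarget := (abs_le.1 (h.target w hw q hq)).2
  have htarget' := (abs_le.1 (h.target.abs_inner_map_sub_inner_le hν₀)).1
  simp only [inner_sub_left, real_inner_smul_left, add_mul, one_mul] at hcompete hcompete' hscale
  linarith

variable {ρ D : ℝ}

theorem mul_norm_le (h : IsDualPerturbation Ψ U δ y A b B) (hδ : 0 ≤ δ)
    (hρ : ρ ≤ inradius U (symmHull A)) (hw : w ∈ U) (hq : q ∈ (U.map Ψ)ᗮ)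
    (hν : IsDualDirection lam b B (Ψ w + q)) : ρ * ‖w‖ ≤ 1 + δ * (‖w‖ + ‖q‖) :=
  (mul_le_mul_of_nonneg_right hρ (norm_nonneg w)).trans
    (inradius_mul_norm_le hw (by positivity) (h.abs_inner_column_le hw hq hν))

theorem mul_mul_norm_orthogonal_le (h : IsDualPerturbation Ψ U δ y A b B) (hlam : 0 ≤ lam)
    (hδ0 : 0 ≤ δ) (hδ1 : δ ≤ 1) (hρ0 : 0 ≤ ρ) (hρ1 : ρ ≤ 1) (hw : w ∈ U) (hq : q ∈ (U.map Ψ)ᗮ)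
    (hν : IsDualDirection lam b B (Ψ w + q)) :
    lam * (ρ * ‖q‖) ≤ δ * (1 + 2 * (ρ * (‖w‖ + ‖q‖))) :=
  calc lam * (ρ * ‖q‖) = ρ * (lam * ‖q‖) := by ring
    _ ≤ ρ * (δ * (1 + ‖w‖ + δ * (‖w‖ + ‖q‖))) :=
        mul_le_mul_of_nonneg_left (h.mul_norm_orthogonal_le hlam hδ0 hw hq hν) hρ0
    _ = δ * (ρ + ρ * ‖w‖ + δ * (ρ * (‖w‖ + ‖q‖))) := by ring
    _ ≤ δ * (1 + ρ * (‖w‖ + ‖q‖) + 1 * (ρ * (‖w‖ + ‖q‖))) := by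
        gcongr
        exact le_add_of_nonneg_right (norm_nonneg q)
    _ = δ * (1 + 2 * (ρ * (‖w‖ + ‖q‖))) := by ring

theorem mul_norm_add_norm_le_two (h : IsDualPerturbation Ψ U δ y A b B) (hlam0 : 0 < lam)
    (hlam1 : lam ≤ 1) (hρ0 : 0 < ρ) (hρ1 : ρ ≤ 1) (hρ : ρ ≤ inradius U (symmHull A)) (hδ0 : 0 ≤ δ)
    (hδ : δ ≤ ρ * lam / 100) (hw : w ∈ U) (hq : q ∈ (U.map Ψ)ᗮ)
    (hν : IsDualDirection lam b B (Ψ w + q)) : ρ * (‖w‖ + ‖q‖) ≤ 2 := by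
  have hδρ : δ ≤ ρ / 100 := by linarith [mul_le_of_le_one_right hρ0.le hlam1]
  have hδlam : δ ≤ lam / 100 := by linarith [mul_le_of_le_one_left hlam0.le hρ1]
  have hw_mul : ρ * ‖w‖ ≤ 1 + ρ / 100 * (‖w‖ + ‖q‖) :=
    (h.mul_norm_le hδ0 hρ hw hq hν).trans (by gcongr)
  have hq_mul : ρ * ‖q‖ ≤ (1 + 2 * (ρ * (‖w‖ + ‖q‖))) / 100 := by
    refine le_of_mul_le_mul_left ?_ hlam0
    calc lam * (ρ * ‖q‖) ≤ δ * (1 + 2 * (ρ * (‖w‖ + ‖q‖))) :=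
          h.mul_mul_norm_orthogonal_le hlam0.le hδ0 (by linarith) hρ0.le hρ1 hw hq hν
      _ ≤ lam / 100 * (1 + 2 * (ρ * (‖w‖ + ‖q‖))) := by gcongr
      _ = lam * ((1 + 2 * (ρ * (‖w‖ + ‖q‖))) / 100) := by ring
  linarith

theorem mul_sq_mul_norm_sub_le (h : IsDualPerturbation Ψ U δ y A b B) (hlam0 : 0 ≤ lam)
    (hlam1 : lam ≤ 1) (hρ0 : 0 < ρ) (hρ1 : ρ ≤ 1) (hδ0 : 0 ≤ δ) (hδ1 : δ ≤ 1) (hν₀ : ν₀ ∈ U)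
    (hdual : IsDualDirection lam y A ν₀) (hw : w ∈ U) (hq : q ∈ (U.map Ψ)ᗮ)
    (hν : IsDualDirection lam b B (Ψ w + q)) (hν₀_le : ρ * ‖ν₀‖ ≤ 2)
    (hν_le : ρ * (‖w‖ + ‖q‖) ≤ 2) : lam * (ρ * ‖w - ν₀‖) ^ 2 ≤ 24 * δ := by
  have hK {t : ℝ} (ht : ρ * t ≤ 2) : t ≤ 2 / ρ := (le_div_iff₀' hρ0).2 ht
  have hcompare := h.mul_sq_norm_sub_le hlam0 hδ0 hδ1 hν₀ hdual hw hq hν (hK hν₀_le) (hK hν_le)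
  calc lam * (ρ * ‖w - ν₀‖) ^ 2 = ρ ^ 2 * (lam * ‖w - ν₀‖ ^ 2) := by ring
    _ ≤ ρ ^ 2 * (δ * (2 * (2 / ρ) + 3 * (2 / ρ) ^ 2 + 2 * lam * (2 / ρ) ^ 2)) := by gcongr
    _ = δ * (4 * ρ + 12 + 8 * lam) := by
        field_simp
        ring
    _ ≤ δ * (4 * 1 + 12 + 8 * 1) := by gcongr
    _ = 24 * δ := by ring

theorem stability (h : IsDualPerturbation Ψ U δ y A b B) (hlam0 : 0 < lam) (hlam1 : lam ≤ 1)
    (hD : 0 < D) (hDρ : D ≤ ρ) (hρ1 : ρ ≤ 1) (hρ : ρ ≤ inradius U (symmHull A)) (hδ0 : 0 ≤ δ)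
    (hδ : δ ≤ D ^ 2 * lam / 20000) (hν₀ : ν₀ ∈ U) (hdual : IsDualDirection lam y A ν₀) (hw : w ∈ U)
    (hq : q ∈ (U.map Ψ)ᗮ) (hν : IsDualDirection lam b B (Ψ w + q)) :
    ρ * ‖w‖ ≤ 1 + D / 1000 ∧ ρ * ‖q‖ ≤ D / 1000 ∧ ρ * ‖w - ν₀‖ ≤ D / 20 := by
  have hρ0 : 0 < ρ := hD.trans_le hDρ
  have hD_sq : D ^ 2 ≤ D * ρ := by
    rw [sq]
    gcongr
  have hDρ_le : D * ρ ≤ ρ := mul_le_of_le_one_left hρ0.le (hDρ.trans hρ1)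
  have hδ_ρ : δ ≤ D * ρ / 20000 := by
    linarith [mul_le_of_le_one_right (sq_nonneg D) hlam1]
  have hδ_size : δ ≤ ρ * lam / 100 := by
    linarith [mul_le_mul_of_nonneg_right (hD_sq.trans hDρ_le) hlam0.le, mul_pos hρ0 hlam0]
  have hsize := h.mul_norm_add_norm_le_two hlam0 hlam1 hρ0 hρ1 hρ hδ0 hδ_size hw hq hν
  refine ⟨?_, ?_, ?_⟩
  · have hδT : δ * (‖w‖ + ‖q‖) ≤ D * ρ / 20000 * (‖w‖ + ‖q‖) := by gcongr
    linarith [h.mul_norm_le hδ0 hρ hw hq hν, mul_le_mul_of_nonneg_left hsize hD.le]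
  · refine le_of_mul_le_mul_left ?_ hlam0
    calc lam * (ρ * ‖q‖) ≤ δ * (1 + 2 * (ρ * (‖w‖ + ‖q‖))) :=
          h.mul_mul_norm_orthogonal_le hlam0.le hδ0 (by linarith) hρ0.le hρ1 hw hq hν
      _ ≤ D * ρ * lam / 20000 * (1 + 2 * 2) := by
          gcongr
          exact hδ.trans (by gcongr)
      _ ≤ D * 1 * lam / 20000 * (1 + 2 * 2) := by gcongr
      _ ≤ lam * (D / 1000) := by linarith [mul_pos hD hlam0]
  · have hν₀_le : ρ * ‖ν₀‖ ≤ 1 := (mul_le_mul_of_nonneg_right hρ (norm_nonneg ν₀)).trans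
      (inradius_mul_norm_le hν₀ zero_le_one hdual.1)
    refine le_of_sq_le_sq (le_of_mul_le_mul_left ?_ hlam0) (by positivity)
    calc lam * (ρ * ‖w - ν₀‖) ^ 2 ≤ 24 * δ :=
          h.mul_sq_mul_norm_sub_le hlam0.le hlam1 hρ0 hρ1 hδ0 (by linarith) hν₀ hdual hw hq hν
            (hν₀_le.trans one_le_two) hsize
      _ ≤ lam * (D / 20) ^ 2 := by linarith [mul_nonneg (sq_nonneg D) hlam0.le]

end IsDualPerturbation

end Perturbation

section Lasso

variable {n N : ℕ} {X : Fin N → Vec n} {lam : ℝ} {i : Fin N}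

/-- The residual `xᵢ - X c` of the coefficient vector `c` in the `i`-th Lasso problem. -/
def lassoResidual (X : Fin N → Vec n) (i : Fin N) (c : Fin N → ℝ) : Vec n :=
  X i - ∑ j, c j • X j

/-- `c` minimizes the `i`-th Lasso objective among the vectors supported on `S`. The Lasso problem
of the statement is the case `S = {i}ᶜ`; the dual direction of a cluster comes from the case where
`S` consists of the other points of the cluster. -/
def IsSupportedLassoSolution (X : Fin N → Vec n) (lam : ℝ) (i : Fin N) (S : Set (Fin N))
    (c : Fin N → ℝ) : Prop :=
  (∀ j ∉ S, c j = 0) ∧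
    ∀ c' : Fin N → ℝ, (∀ j ∉ S, c' j = 0) → lassoObjective X lam i c ≤ lassoObjective X lam i c'

theorem isSupportedLassoSolution_compl_singleton {c : Fin N → ℝ} :
    IsSupportedLassoSolution X lam i {i}ᶜ c ↔ IsLassoSolution X lam i c := by
  simp [IsSupportedLassoSolution, IsLassoSolution]

theorem lassoObjective_eq (X : Fin N → Vec n) (lam : ℝ) (i : Fin N) (c : Fin N → ℝ) :
    lassoObjective X lam i c = ‖lassoResidual X i c‖ ^ 2 + 2 * lam * ∑ j, |c j| :=
  rfl

theorem two_mul_norm_le_lassoObjective (hlam : 0 ≤ lam) (c : Fin N → ℝ) :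
    2 * lam * ‖c‖ ≤ lassoObjective X lam i c := by
  have hnorm : ‖c‖ ≤ ∑ j, |c j| :=
    (pi_norm_le_iff_of_nonneg (by positivity)).2 fun j =>
      Finset.single_le_sum (fun l _ => abs_nonneg (c l)) (Finset.mem_univ j)
  rw [lassoObjective_eq]
  linarith [mul_le_mul_of_nonneg_left hnorm hlam, sq_nonneg ‖lassoResidual X i c‖]

theorem exists_isSupportedLassoSolution (X : Fin N → Vec n) (hlam : 0 < lam) (i : Fin N)
    (S : Set (Fin N)) : ∃ c, IsSupportedLassoSolution X lam i S c := by
  have hclosed : IsClosed {c : Fin N → ℝ | ∀ j ∉ S, c j = 0} := by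
    simp only [Set.ofPred_forall]
    exact isClosed_iInter fun j => isClosed_iInter fun _ =>
      isClosed_eq (continuous_apply j) continuous_const
  have hcont : Continuous (lassoObjective X lam i) := by
    unfold lassoObjective
    fun_prop
  have hcoercive : Filter.Tendsto (lassoObjective X lam i) (Filter.cocompact _) Filter.atTop :=
    Filter.tendsto_atTop_mono (two_mul_norm_le_lassoObjective hlam.le)
      ((tendsto_norm_cocompact_atTop (E := Fin N → ℝ)).const_mul_atTop (by positivity))
  exact hcont.continuousOn.exists_isMinOn' hclosed (fun _ _ => rfl)
    ((hcoercive.eventually_ge_atTop (lassoObjective X lam i 0)).filter_mono inf_le_left)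

theorem lassoResidual_add (X : Fin N → Vec n) (i : Fin N) (c a : Fin N → ℝ) :
    lassoResidual X i (c + a) = lassoResidual X i c - ∑ j, a j • X j := by
  simp only [lassoResidual, Pi.add_apply, add_smul, Finset.sum_add_distrib, sub_sub]

theorem lassoObjective_add_single (X : Fin N → Vec n) (lam : ℝ) (i : Fin N) (c : Fin N → ℝ)
    (j : Fin N) (t : ℝ) :
    lassoObjective X lam i (c + Pi.single j t) = lassoObjective X lam i c
      + 2 * (lam * (|c j + t| - |c j|) - t * ⟪X j, lassoResidual X i c⟫) + t ^ 2 * ‖X j‖ ^ 2 := by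
  have hl1 : ∑ l, (|(c + Pi.single j t : Fin N → ℝ) l| - |c l|) = |c j + t| - |c j| := by
    rw [Finset.sum_eq_single j (fun l _ hl => by simp [hl]) (by simp)]
    simp
  have hsum : ∑ l, Pi.single (M := fun _ => ℝ) j t l • X l = t • X j := by
    simp [Pi.single_apply, ite_smul]
  rw [Finset.sum_sub_distrib] at hl1
  rw [lassoObjective_eq, lassoObjective_eq, lassoResidual_add, hsum, norm_sub_sq_real, norm_smul,
    real_inner_smul_right, real_inner_comm, mul_pow, Real.norm_eq_abs, sq_abs]
  linear_combination 2 * lam * hl1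

namespace IsSupportedLassoSolution

variable {S : Set (Fin N)} {c : Fin N → ℝ}

theorem mul_inner_residual_le (h : IsSupportedLassoSolution X lam i S c) (hlam : 0 ≤ lam)
    {j : Fin N} (hj : j ∈ S) (t : ℝ) :
    t * ⟪X j, lassoResidual X i c⟫ ≤ lam * (|c j + t| - |c j|) := by
  refine sub_nonpos.1 (nonpos_of_forall_mul_le_sq_mul (B := t ^ 2 * ‖X j‖ ^ 2 / 2) ?_)
  intro τ hτ0 hτ1
  have hsupport : ∀ l ∉ S, (c + Pi.single j (τ * t) : Fin N → ℝ) l = 0 := by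
    intro l hl
    rw [Pi.add_apply, h.1 l hl, Pi.single_eq_of_ne (ne_of_mem_of_not_mem hj hl).symm, add_zero]
  have hle := h.2 _ hsupport
  have hconvex : |c j + τ * t| - |c j| ≤ τ * (|c j + t| - |c j|) := by
    calc |c j + τ * t| - |c j| = |(1 - τ) * c j + τ * (c j + t)| - |c j| := by
          congr 2
          ring
      _ ≤ |1 - τ| * |c j| + |τ| * |c j + t| - |c j| := by
          rw [← abs_mul, ← abs_mul]
          gcongr
          exact abs_add_le _ _
      _ = τ * (|c j + t| - |c j|) := by
          rw [abs_of_nonneg hτ0.le, abs_of_nonneg (sub_nonneg.2 hτ1)]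
          ring
  rw [lassoObjective_add_single] at hle
  linarith [mul_le_mul_of_nonneg_left hconvex hlam]

theorem abs_inner_residual_le (h : IsSupportedLassoSolution X lam i S c) (hlam : 0 ≤ lam)
    {j : Fin N} (hj : j ∈ S) : |⟪X j, lassoResidual X i c⟫| ≤ lam := by
  have hshift (t : ℝ) (ht : |t| = 1) : t * ⟪X j, lassoResidual X i c⟫ ≤ lam :=
    (h.mul_inner_residual_le hlam hj t).trans
      (mul_le_of_le_one_right hlam (by linarith [abs_add_le (c j) t]))
  exact abs_le.2 ⟨by linarith [hshift (-1) (by simp)], by linarith [hshift 1 (by simp)]⟩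

theorem mul_inner_residual_eq (h : IsSupportedLassoSolution X lam i S c) (hlam : 0 ≤ lam)
    (j : Fin N) : c j * ⟪X j, lassoResidual X i c⟫ = lam * |c j| := by
  by_cases hj : j ∈ S
  · have hgrow := h.mul_inner_residual_le hlam hj (c j)
    have hshrink := h.mul_inner_residual_le hlam hj (-c j)
    rw [← two_mul, abs_mul, abs_two] at hgrow
    rw [add_neg_cancel, abs_zero] at hshrink
    linarith
  · simp [h.1 j hj]

theorem isDualDirection (h : IsSupportedLassoSolution X lam i S c) (hlam : 0 < lam) :
    IsDualDirection lam (X i) (fun j : S => X j) (lam⁻¹ • lassoResidual X i c) := by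
  have hfeasible (j : S) : |⟪X j, lam⁻¹ • lassoResidual X i c⟫| ≤ 1 :=
    abs_inner_inv_smul_le_one hlam (h.abs_inner_residual_le hlam.le j.2)
  have hslack (j : Fin N) : c j * ⟪X j, lam⁻¹ • lassoResidual X i c⟫ = |c j| := by
    rw [real_inner_smul_right, mul_left_comm, h.mul_inner_residual_eq hlam.le,
      inv_mul_cancel_left₀ hlam.ne']
  refine (isDualDirection_iff_inner_le hlam.le).2 ⟨hfeasible, fun w hw => ?_⟩
  have hcombination : X i - lam • lam⁻¹ • lassoResidual X i c = ∑ j, c j • X j := by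
    rw [smul_inv_smul₀ hlam.ne', lassoResidual, sub_sub_cancel]
  simp only [hcombination, sum_inner, real_inner_smul_left, hslack]
  refine Finset.sum_le_sum fun j _ => ?_
  by_cases hj : j ∈ S
  · refine (le_abs_self _).trans ?_
    rw [abs_mul]
    exact mul_le_of_le_one_right (abs_nonneg _) (hw ⟨j, hj⟩)
  · simp [h.1 j hj]

theorem lassoObjective_add_two_mul_sum_le (h : IsSupportedLassoSolution X lam i S c)
    (hlam : 0 ≤ lam) (a : Fin N → ℝ) :
    lassoObjective X lam i c + 2 * ∑ j, (lam * |a j| - a j * ⟪X j, lassoResidual X i c⟫)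
      ≤ lassoObjective X lam i a := by
  set r := lassoResidual X i c with hr
  have hresidual : lassoResidual X i a = r - ∑ j, (a j - c j) • X j := by
    simpa only [add_sub_cancel, Pi.sub_apply] using lassoResidual_add X i c (a - c)
  have hinner : ⟪r, ∑ j, (a j - c j) • X j⟫ = ∑ j, a j * ⟪X j, r⟫ - lam * ∑ j, |c j| := by
    rw [inner_sum, Finset.mul_sum, ← Finset.sum_sub_distrib]
    refine Finset.sum_congr rfl fun j _ => ?_
    rw [real_inner_smul_right, real_inner_comm, sub_mul, h.mul_inner_residual_eq hlam j]
  rw [lassoObjective_eq, lassoObjective_eq, ← hr, hresidual, norm_sub_sq_real, hinner,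
    Finset.sum_sub_distrib, ← Finset.mul_sum]
  linarith [sq_nonneg ‖∑ j, (a j - c j) • X j‖]

end IsSupportedLassoSolution

theorem IsLassoSolution.eq_zero_of_abs_inner_lt_one {c : Fin N → ℝ}
    (hc : IsLassoSolution X lam i c) (hlam : 0 < lam) {S : Set (Fin N)} (hi : i ∉ S) {ν : Vec n}
    (hν : IsDualDirection lam (X i) (fun j : S => X j) ν)
    (hS : ∀ j ∉ S, j ≠ i → |⟪X j, ν⟫| < 1) {j : Fin N} (hj : j ∉ S) : c j = 0 := by
  rcases eq_or_ne j i with rfl | hji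
  · exact hc.1
  obtain ⟨a, ha⟩ := exists_isSupportedLassoSolution X hlam i S
  obtain rfl : ν = lam⁻¹ • lassoResidual X i a :=
    (existsUnique_isDualDirection hlam _ _).unique hν (ha.isDualDirection hlam)
  set r := lassoResidual X i a
  have hoff {l : Fin N} (hl : l ∉ S) (hli : l ≠ i) : |⟪X l, r⟫| < lam := by
    have hlt := hS l hl hli
    rwa [real_inner_smul_right, abs_mul, abs_of_pos (inv_pos.2 hlam), inv_mul_lt_iff₀ hlam,
      mul_one] at hlt
  have hle (l : Fin N) : c l * ⟪X l, r⟫ ≤ |c l| * |⟪X l, r⟫| := by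
    rw [← abs_mul]
    exact le_abs_self _
  have hgap_nonneg (l : Fin N) : 0 ≤ lam * |c l| - c l * ⟪X l, r⟫ := by
    rcases eq_or_ne l i with rfl | hli
    · simp [hc.1]
    have hr : |⟪X l, r⟫| ≤ lam := by
      by_cases hl : l ∈ S
      exacts [ha.abs_inner_residual_le hlam.le hl, (hoff hl hli).le]
    linarith [hle l, mul_le_mul_of_nonneg_left hr (abs_nonneg (c l))]
  have hgap_le := ha.lassoObjective_add_two_mul_sum_le hlam.le c
  have hoptimal := hc.2 a (ha.1 i hi)
  have hgap_j := Finset.single_le_sum (fun l _ => hgap_nonneg l) (Finset.mem_univ j)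
  by_contra hcj
  linarith [hle j, mul_lt_mul_of_pos_left (hoff hj hji) (abs_pos.2 hcj)]

end Lasso

section Clusters

variable {d p N k : ℕ} {Ψ : Vec d →ₗ[ℝ] Vec p} {U : Fin k → Submodule ℝ (Vec d)}
  {label : Fin N → Fin k} {Y Z : Fin N → Vec d} {lam ε τ η D : ℝ}

theorem clusterInradius_le_inradius (U : Fin k → Submodule ℝ (Vec d)) (label : Fin N → Fin k)
    (Y : Fin N → Vec d) (i : Fin N) :
    clusterInradius U label Y (label i)
      ≤ inradius (U (label i)) (symmHull (clusterWithout Y label i)) :=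
  ciInf_le (f := fun i' : {i' : Fin N // label i' = label i} =>
    inradius (U (label i)) (symmHull (clusterWithout Y label i')))
    (Set.finite_range _).bddBelow ⟨i, rfl⟩

theorem clusterInradius_le_one (hYU : ∀ i, Y i ∈ U (label i)) (hY : ∀ i, ‖Y i‖ = 1) (i : Fin N) :
    clusterInradius U label Y (label i) ≤ 1 := by
  refine (clusterInradius_le_inradius U label Y i).trans ?_
  have hle := inradius_mul_norm_le (A := clusterWithout Y label i) (hYU i) zero_le_one fun j =>
    (abs_real_inner_le_norm _ _).trans_eq (by rw [clusterWithout, hY, hY, one_mul])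
  rwa [hY, mul_one] at hle

theorem minInradius_nonneg (U : Fin k → Submodule ℝ (Vec d)) (label : Fin N → Fin k)
    (Y : Fin N → Vec d) : 0 ≤ minInradius U label Y :=
  Real.iInf_nonneg fun _ => Real.iInf_nonneg fun _ => inradius_nonneg _ _

theorem minInradius_le_clusterInradius (U : Fin k → Submodule ℝ (Vec d)) (label : Fin N → Fin k)
    (Y : Fin N → Vec d) (l : Fin k) : minInradius U label Y ≤ clusterInradius U label Y l :=
  ciInf_le (Set.finite_range _).bddBelow l

theorem lt_one_of_lt_minInradius_mul (hYU : ∀ i, Y i ∈ U (label i)) (hY : ∀ i, ‖Y i‖ = 1)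
    (i : Fin N) (hε : 0 ≤ ε) (hη : 0 ≤ η) (hlam : lam < minInradius U label Y * (1 - ε) - 6 * η) :
    lam < 1 := by
  have hmin_le := (minInradius_le_clusterInradius U label Y (label i)).trans
    (clusterInradius_le_one hYU hY i)
  linarith [mul_nonneg (minInradius_nonneg U label Y) hε]

theorem incoherence_nonneg (U : Fin k → Submodule ℝ (Vec d)) (label : Fin N → Fin k) (lam : ℝ)
    (X : Fin N → Vec d) (l : Fin k) : 0 ≤ incoherence U label lam X l :=
  Real.iSup_nonneg fun _ => Real.iSup_nonneg fun _ => abs_nonneg _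

theorem abs_inner_projectedDual_le_incoherence (U : Fin k → Submodule ℝ (Vec d))
    (label : Fin N → Fin k) (lam : ℝ) (X : Fin N → Vec d) {i j : Fin N}
    (hij : label j ≠ label i) :
    |⟪projectedDual U label lam X i, X j⟫| ≤ incoherence U label lam X (label i) := by
  refine le_ciSup_of_le (Set.finite_range _).bddAbove ⟨i, rfl⟩ ?_
  exact le_ciSup (f := fun j : {j : Fin N // label j ≠ label i} =>
    |⟪projectedDual U label lam X i, X j⟫|) (Set.finite_range _).bddAbove ⟨j, hij⟩

theorem abs_inner_le_incoherence_mul_norm {X : Fin N → Vec d} {i j : Fin N} {v q : Vec d}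
    (hij : label j ≠ label i) (hv : v ∈ U (label i)) (hq : q ∈ (U (label i))ᗮ)
    (hν : v + q = dualDirection lam (X i) (clusterWithout X label i)) :
    |⟪X j, v⟫| ≤ incoherence U label lam X (label i) * ‖v‖ := by
  rcases eq_or_ne v 0 with rfl | hv0
  · simp
  have hprojected : projectedDual U label lam X i = ‖v‖⁻¹ • v := by
    have hproj : (U (label i)).starProjection (v + q) = v :=
      Submodule.eq_starProjection_of_mem_orthogonal hv (by rwa [add_sub_cancel_left])
    rw [projectedDual, ← hν, hproj]
  have hle := abs_inner_projectedDual_le_incoherence U label lam X hij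
  rwa [hprojected, real_inner_smul_left, abs_mul, abs_inv, abs_norm, real_inner_comm,
    inv_mul_le_iff₀ (norm_pos_iff.2 hv0), mul_comm] at hle

theorem gap_le_clusterInradius_sub_incoherence (U : Fin k → Submodule ℝ (Vec d))
    (label : Fin N → Fin k) (lam : ℝ) (Y Z : Fin N → Vec d) (l : Fin k) :
    gap U label lam Y Z ≤ clusterInradius U label Y l - incoherence U label lam (Y + Z) l :=
  ciInf_le (f := fun l => clusterInradius U label Y l - incoherence U label lam (Y + Z) l)
    (Set.finite_range _).bddBelow l

theorem gap_pos [Nonempty (Fin k)]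
    (h : ∀ l, incoherence U label lam (Y + Z) l < clusterInradius U label Y l) :
    0 < gap U label lam Y Z := by
  obtain ⟨l, hl⟩ := exists_eq_ciInf_of_finite
    (f := fun l => clusterInradius U label Y l - incoherence U label lam (Y + Z) l)
  rw [gap, ← hl]
  exact sub_pos.2 (h l)

theorem WellBehaved.nearlyPreservesInner {X : Fin N → Vec d} (h : WellBehaved Ψ U X Z ε)
    (l l' : Fin k) : NearlyPreservesInner Ψ ε (U l) (U l') := by
  intro x hx y hy
  rcases eq_or_ne x 0 with rfl | hx0
  · simp
  rcases eq_or_ne y 0 with rfl | hy0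
  · simp
  have hunit := h.inner_approx l l' (‖x‖⁻¹ • x) (Or.inl ((U l).smul_mem _ hx)) (‖y‖⁻¹ • y)
    (Or.inr ((U l').smul_mem _ hy))
  have hscale : ⟪x, y⟫ - ⟪Ψ x, Ψ y⟫
      = ‖x‖ * ‖y‖ * (⟪‖x‖⁻¹ • x, ‖y‖⁻¹ • y⟫ - ⟪Ψ (‖x‖⁻¹ • x), Ψ (‖y‖⁻¹ • y)⟫) := by
    simp only [map_smul, real_inner_smul_left, real_inner_smul_right]
    field_simp
  have hnorm {v : Vec d} (hv : v ≠ 0) : ‖‖v‖⁻¹ • v‖ = 1 := by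
    rw [norm_smul, norm_inv, norm_norm, inv_mul_cancel₀ (norm_ne_zero_iff.2 hv)]
  rw [hnorm hx0, hnorm hy0, one_pow, add_self_div_two, mul_one] at hunit
  rw [hscale, abs_mul, abs_of_nonneg (by positivity)]
  exact (mul_le_mul_of_nonneg_left hunit (by positivity)).trans_eq (by ring)

/-- The hypotheses on the noisy compressed data: unit vectors `Y i` in the subspaces of their
clusters, a map `Ψ` preserving inner products up to `ε` on these subspaces, and noise whose
image is bounded by `τ`. The uncompressed noisy data are the case `Ψ = id`, `ε = 0`. -/
structure IsNoisyCompression (Ψ : Vec d →ₗ[ℝ] Vec p) (U : Fin k → Submodule ℝ (Vec d))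
    (label : Fin N → Fin k) (Y Z : Fin N → Vec d) (ε τ : ℝ) : Prop where
  mem : ∀ i, Y i ∈ U (label i)
  norm_eq_one : ∀ i, ‖Y i‖ = 1
  norm_map_noise_le : ∀ i, ‖Ψ (Z i)‖ ≤ τ
  nearlyPreservesInner : ∀ l l', NearlyPreservesInner Ψ ε (U l) (U l')

theorem compressed_id (Z : Fin N → Vec d) (hY : ∀ i, ‖Y i‖ = 1) :
    compressed LinearMap.id Y Z = Y + Z := by
  funext i
  simp [compressed, hY i]

theorem isNoisyCompression_id (hYU : ∀ i, Y i ∈ U (label i)) (hY : ∀ i, ‖Y i‖ = 1)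
    (hZ : ∀ i, ‖Z i‖ ≤ η) : IsNoisyCompression LinearMap.id U label Y Z 0 η where
  mem := hYU
  norm_eq_one := hY
  norm_map_noise_le := hZ
  nearlyPreservesInner _ _ _ _ _ _ := by simp

namespace IsNoisyCompression

theorem abs_one_sub_sq_norm_map_le (h : IsNoisyCompression Ψ U label Y Z ε τ) (i : Fin N) :
    |1 - ‖Ψ (Y i)‖ ^ 2| ≤ ε := by
  simpa [h.norm_eq_one i] using (h.nearlyPreservesInner _ _).abs_sq_norm_sub_le (h.mem i)

theorem nonneg_left (h : IsNoisyCompression Ψ U label Y Z ε τ) (i : Fin N) : 0 ≤ ε :=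
  (h.nearlyPreservesInner _ _).nonneg (h.mem i) (h.norm_eq_one i)

theorem nonneg_right (h : IsNoisyCompression Ψ U label Y Z ε τ) (i : Fin N) : 0 ≤ τ :=
  (norm_nonneg _).trans (h.norm_map_noise_le i)

theorem norm_compressed_sub_map_le (h : IsNoisyCompression Ψ U label Y Z ε τ) (i : Fin N) :
    ‖compressed Ψ Y Z i - Ψ (Y i)‖ ≤ ε + τ := by
  rw [compressed, add_sub_right_comm]
  exact norm_add_le_of_le ((norm_inv_norm_smul_sub_self_le _).trans
    (h.abs_one_sub_sq_norm_map_le i)) (h.norm_map_noise_le i)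

theorem norm_compressed_le (h : IsNoisyCompression Ψ U label Y Z ε τ) (i : Fin N) :
    ‖compressed Ψ Y Z i‖ ≤ 1 + τ :=
  norm_add_le_of_le (norm_inv_norm_smul_le_one _) (h.norm_map_noise_le i)

theorem isDualPerturbation (h : IsNoisyCompression Ψ U label Y Z ε τ) (hε : ε ≤ 3) (i : Fin N) :
    IsDualPerturbation Ψ (U (label i)) (2 * (ε + τ) + ε) (Y i) (clusterWithout Y label i)
      (compressed Ψ Y Z i) (clusterWithout (compressed Ψ Y Z) label i) := by
  have hmem {j : Fin N} (hj : label j = label i) : Y j ∈ U (label i) := hj ▸ h.mem j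
  have himage {j : Fin N} (hj : label j = label i) :
      IsApproxImage Ψ (U (label i)) (2 * (ε + τ) + ε) (Y j) (compressed Ψ Y Z j) :=
    isApproxImage_of_norm_sub_le (h.nearlyPreservesInner _ _) (h.nonneg_left i) hε (hmem hj)
      (h.norm_eq_one j) (h.norm_compressed_sub_map_le j)
  exact
    { mem_target := h.mem i
      mem_column := fun j => hmem j.2.1
      norm_target_le_one := (h.norm_eq_one i).le
      nearlyPreservesInner := (h.nearlyPreservesInner _ _).mono
        (by linarith [h.nonneg_left i, h.nonneg_right i])
      target := himage rfl
      column := fun j => himage j.2.1 }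

theorem exists_stable_decomposition (h : IsNoisyCompression Ψ U label Y Z ε τ) (hlam0 : 0 < lam)
    (hlam1 : lam ≤ 1) {i : Fin N} (hD0 : 0 < D) (hDρ : D ≤ clusterInradius U label Y (label i))
    (hδ : 2 * (ε + τ) + ε ≤ D ^ 2 * lam / 20000) :
    ∃ w ∈ U (label i), ∃ q ∈ ((U (label i)).map Ψ)ᗮ,
      Ψ w + q = dualDirection lam (compressed Ψ Y Z i) (clusterWithout (compressed Ψ Y Z) label i) ∧
      clusterInradius U label Y (label i) * ‖w‖ ≤ 1 + D / 1000 ∧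
      clusterInradius U label Y (label i) * ‖q‖ ≤ D / 1000 ∧
      clusterInradius U label Y (label i)
        * ‖w - dualDirection lam (Y i) (clusterWithout Y label i)‖ ≤ D / 20 := by
  have hε0 := h.nonneg_left i
  have hτ0 := h.nonneg_right i
  have hρ1 := clusterInradius_le_one h.mem h.norm_eq_one i
  have hD1 : D ^ 2 * lam ≤ 1 :=
    mul_le_one₀ (pow_le_one₀ hD0.le (hDρ.trans hρ1)) hlam0.le hlam1
  have hpert := h.isDualPerturbation (by linarith) i
  have hdual := dualDirection_spec hlam0 (Y i) (clusterWithout Y label i)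
  have hν := dualDirection_spec hlam0 (compressed Ψ Y Z i)
    (clusterWithout (compressed Ψ Y Z) label i)
  set ν := dualDirection lam (compressed Ψ Y Z i) (clusterWithout (compressed Ψ Y Z) label i)
  obtain ⟨w, hw, hwν⟩ := ((U (label i)).map Ψ).starProjection_apply_mem ν
  have hsum : Ψ w + (ν - Ψ w) = ν := add_sub_cancel _ _
  have hq : ν - Ψ w ∈ ((U (label i)).map Ψ)ᗮ := by
    rw [hwν]
    exact Submodule.sub_starProjection_mem_orthogonal ν
  exact ⟨w, hw, ν - Ψ w, hq, hsum, hpert.stability hlam0 hlam1 hD0 hDρ hρ1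
    (clusterInradius_le_inradius U label Y i) (by positivity) hδ
    (hdual.mem_of_forall_mem hlam0 (h.mem i) hpert.mem_column) hdual hw hq (hsum.symm ▸ hν)⟩

theorem abs_inner_compressed_le (h : IsNoisyCompression Ψ U label Y Z ε τ) (hε : ε ≤ 3)
    {l : Fin k} {w : Vec d} (hw : w ∈ U l) (q : Vec p) (j : Fin N) :
    |⟪compressed Ψ Y Z j, Ψ w + q⟫|
      ≤ |⟪Y j, w⟫| + (2 * (ε + τ) + ε) * ‖w‖ + (1 + τ) * ‖q‖ := by
  have himage := (h.nearlyPreservesInner (label j) l).abs_inner_map_sub_inner_le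
    (h.nearlyPreservesInner l l) hε (h.mem j) (h.norm_eq_one j) hw (h.norm_compressed_sub_map_le j)
  have horthogonal : |⟪compressed Ψ Y Z j, q⟫| ≤ (1 + τ) * ‖q‖ :=
    (abs_real_inner_le_norm _ _).trans (by gcongr; exact h.norm_compressed_le j)
  rw [inner_add_right]
  linarith [abs_add_le ⟪compressed Ψ Y Z j, Ψ w⟫ ⟪compressed Ψ Y Z j, q⟫,
    abs_sub_abs_le_abs_sub ⟪compressed Ψ Y Z j, Ψ w⟫ ⟪Y j, w⟫]

theorem exists_abs_inner_le_incoherence (h : IsNoisyCompression LinearMap.id U label Y Z 0 η)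
    (hlam0 : 0 < lam) (hlam1 : lam ≤ 1) {i : Fin N} (hD0 : 0 < D)
    (hDρ : D ≤ clusterInradius U label Y (label i)) (hη : 2 * η ≤ D ^ 2 * lam / 20000) :
    ∃ w₁ : Vec d, clusterInradius U label Y (label i) * ‖w₁‖ ≤ 1 + D / 1000 ∧
      clusterInradius U label Y (label i)
        * ‖w₁ - dualDirection lam (Y i) (clusterWithout Y label i)‖ ≤ D / 20 ∧
      ∀ j, label j ≠ label i → ∀ w, |⟪Y j, w⟫|
        ≤ ‖w - w₁‖ + (incoherence U label lam (Y + Z) (label i) + η) * ‖w₁‖ := by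
  obtain ⟨w₁, hw₁, q₁, hq₁, hsum, hnorm, -, hdist⟩ :=
    h.exists_stable_decomposition hlam0 hlam1 hD0 hDρ (by linarith)
  rw [compressed_id Z h.norm_eq_one, LinearMap.id_apply] at hsum
  rw [Submodule.map_id] at hq₁
  refine ⟨w₁, hnorm, hdist, fun j hij w => ?_⟩
  exact abs_inner_le_norm_sub_add_mul (h.norm_eq_one j).le (h.norm_map_noise_le j)
    (abs_inner_le_incoherence_mul_norm hij hw₁ hq₁ hsum)

theorem abs_inner_dualDirection_lt_one (h : IsNoisyCompression Ψ U label Y Z ε τ)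
    (hZ : ∀ i, ‖Z i‖ ≤ η) (hlam0 : 0 < lam) (hlam1 : lam ≤ 1) {i j : Fin N}
    (hij : label j ≠ label i) (hD0 : 0 < D)
    (hDρ : incoherence U label lam (Y + Z) (label i) + D ≤ clusterInradius U label Y (label i))
    (hδ : 2 * (ε + τ) + ε ≤ D ^ 2 * lam / 20000) (hη : 2 * η ≤ D ^ 2 * lam / 20000) :
    |⟪compressed Ψ Y Z j,
      dualDirection lam (compressed Ψ Y Z i) (clusterWithout (compressed Ψ Y Z) label i)⟫| < 1 := by
  have hε0 := h.nonneg_left i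
  have hτ0 := h.nonneg_right i
  have hη0 : 0 ≤ η := (norm_nonneg _).trans (hZ i)
  have hμ0 := incoherence_nonneg U label lam (Y + Z) (label i)
  have hρ1 := clusterInradius_le_one h.mem h.norm_eq_one i
  have hD_le_ρ : D ≤ clusterInradius U label Y (label i) := by linarith
  have hD2 : D ^ 2 * lam ≤ D := by
    rw [sq, mul_assoc]
    exact mul_le_of_le_one_right hD0.le (mul_le_one₀ (hD_le_ρ.trans hρ1) hlam0.le hlam1)
  obtain ⟨w, hw, q, -, hsum, hw_norm, hq_norm, hw_dist⟩ :=
    h.exists_stable_decomposition hlam0 hlam1 hD0 hD_le_ρ hδ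
  obtain ⟨w₁, hw₁_norm, hw₁_dist, hw₁⟩ :=
    (isNoisyCompression_id h.mem h.norm_eq_one hZ).exists_abs_inner_le_incoherence
      hlam0 hlam1 hD0 hD_le_ρ hη
  set ρ := clusterInradius U label Y (label i)
  set μ := incoherence U label lam (Y + Z) (label i)
  set ν₀ := dualDirection lam (Y i) (clusterWithout Y label i)
  have hρ0 : 0 < ρ := hD0.trans_le hD_le_ρ
  have hww₁ : ρ * ‖w - w₁‖ ≤ D / 10 := by
    have htriangle := norm_sub_le_norm_sub_add_norm_sub w ν₀ w₁
    rw [norm_sub_rev ν₀] at htriangle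
    linarith [mul_le_mul_of_nonneg_left htriangle hρ0.le]
  rw [← hsum]
  refine lt_of_mul_lt_mul_left ?_ hρ0.le
  calc ρ * |⟪compressed Ψ Y Z j, Ψ w + q⟫|
      ≤ ρ * (‖w - w₁‖ + (μ + η) * ‖w₁‖ + (2 * (ε + τ) + ε) * ‖w‖ + (1 + τ) * ‖q‖) := by
        gcongr
        exact (h.abs_inner_compressed_le (by linarith) hw q j).trans (by gcongr; exact hw₁ j hij w)
    _ = ρ * ‖w - w₁‖ + (μ + η) * (ρ * ‖w₁‖) + (2 * (ε + τ) + ε) * (ρ * ‖w‖)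
          + (1 + τ) * (ρ * ‖q‖) := by ring
    _ ≤ D / 10 + (μ + η) * (1 + D / 1000) + D / 20000 * (1 + D / 1000) + 2 * (D / 1000) := by
        gcongr <;> linarith
    _ < ρ * 1 := by nlinarith

theorem norm_map_le_one_add (h : IsNoisyCompression Ψ U label Y Z ε τ) (i : Fin N) :
    ‖Ψ (Y i)‖ ≤ 1 + ε / 2 := by
  have hε0 := h.nonneg_left i
  refine le_of_sq_le_sq ?_ (by positivity)
  linarith [(abs_le.1 (h.abs_one_sub_sq_norm_map_le i)).1, sq_nonneg ε]

theorem clusterInradius_mul_norm_map_le (h : IsNoisyCompression Ψ U label Y Z ε τ)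
    (hlam : 0 ≤ lam) {i : Fin N} (h0 : IsLassoSolution (compressed Ψ Y Z) lam i 0) :
    clusterInradius U label Y (label i) * ‖Ψ (Y i)‖
      ≤ (1 + ε / 2) * (lam + 2 * τ + τ ^ 2) := by
  set u : Fin N → Vec p := fun j => ‖Ψ (Y j)‖⁻¹ • Ψ (Y j)
  have hu (j : Fin N) : ‖Ψ (Y j)‖ • u j = Ψ (Y j) := by
    rcases eq_or_ne (Ψ (Y j)) 0 with hzero | hne
    · simp [hzero]
    · exact smul_inv_smul₀ (norm_ne_zero_iff.2 hne) _
  have hcorrelation {j : Fin N} (hji : j ≠ i) : |⟪u j, u i⟫| ≤ lam + 2 * τ + τ ^ 2 := by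
    have hresidual := (isSupportedLassoSolution_compl_singleton.2 h0).abs_inner_residual_le hlam
      (Set.mem_compl_singleton_iff.2 hji)
    simp only [lassoResidual, Pi.zero_apply, zero_smul, Finset.sum_const_zero, sub_zero]
      at hresidual
    refine (abs_inner_le_abs_inner_add_add (norm_inv_norm_smul_le_one _)
      (norm_inv_norm_smul_le_one _) (h.norm_map_noise_le j) (h.norm_map_noise_le i)).trans ?_
    gcongr
    exact hresidual
  have hcolumn (j : {j : Fin N // label j = label i ∧ j ≠ i}) :
      |⟪Ψ (clusterWithout Y label i j), u i⟫| ≤ (1 + ε / 2) * (lam + 2 * τ + τ ^ 2) := by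
    rw [clusterWithout, ← hu, real_inner_smul_left, abs_mul, abs_norm]
    gcongr
    exacts [by linarith [h.nonneg_left i], h.norm_map_le_one_add j, hcorrelation j.2.2]
  have hself : ⟪Ψ (Y i), u i⟫ = ‖Ψ (Y i)‖ := by
    rw [real_inner_smul_right, real_inner_self_eq_norm_mul_norm, ← mul_assoc,
      inv_mul_mul_self]
  have hτ0 := h.nonneg_right i
  have hε0 := h.nonneg_left i
  have hinradius := inradius_mul_apply_le (f := (innerₗ _ (u i)).comp Ψ)
    (M := (1 + ε / 2) * (lam + 2 * τ + τ ^ 2)) (h.mem i) (by positivity)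
    fun j => by
      simpa only [LinearMap.comp_apply, innerₗ_apply_apply, real_inner_comm] using hcolumn j
  rw [LinearMap.comp_apply, innerₗ_apply_apply, real_inner_comm, hself, h.norm_eq_one,
    mul_one] at hinradius
  exact (mul_le_mul_of_nonneg_right (clusterInradius_le_inradius U label Y i)
    (norm_nonneg _)).trans hinradius

theorem not_isLassoSolution_zero (h : IsNoisyCompression Ψ U label Y Z ε τ) (hlam : 0 ≤ lam)
    (hε : ε ≤ 1) {i : Fin N}
    (hlam_lt : lam + 2 * τ + τ ^ 2 < clusterInradius U label Y (label i) * (1 - ε)) :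
    ¬ IsLassoSolution (compressed Ψ Y Z) lam i 0 := by
  intro h0
  have hε0 := h.nonneg_left i
  have hτ0 := h.nonneg_right i
  have hρ0 : 0 < clusterInradius U label Y (label i) :=
    pos_of_mul_pos_left (lt_of_le_of_lt (by positivity) hlam_lt) (sub_nonneg.2 hε)
  have hnorm_lt : ‖Ψ (Y i)‖ < (1 + ε / 2) * (1 - ε) := by
    refine lt_of_mul_lt_mul_left ?_ hρ0.le
    calc clusterInradius U label Y (label i) * ‖Ψ (Y i)‖
        ≤ (1 + ε / 2) * (lam + 2 * τ + τ ^ 2) := h.clusterInradius_mul_norm_map_le hlam h0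
      _ < (1 + ε / 2) * (clusterInradius U label Y (label i) * (1 - ε)) := by gcongr
      _ = clusterInradius U label Y (label i) * ((1 + ε / 2) * (1 - ε)) := by ring
  have hsq_lt : ‖Ψ (Y i)‖ ^ 2 < ((1 + ε / 2) * (1 - ε)) ^ 2 := by gcongr
  have hsq_ge : 1 - ε ≤ ‖Ψ (Y i)‖ ^ 2 := by
    linarith [(abs_le.1 (h.abs_one_sub_sq_norm_map_le i)).2]
  have hfactor : (1 + ε / 2) ^ 2 * (1 - ε) ≤ 1 := by nlinarith [sq_nonneg ε, pow_nonneg hε0 3]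
  linarith [mul_le_mul_of_nonneg_right hfactor (sub_nonneg.2 hε)]

theorem subspaceDetection (h : IsNoisyCompression Ψ U label Y Z ε τ) (hZ : ∀ i, ‖Z i‖ ≤ η)
    (hlam0 : 0 < lam) (hlam1 : lam ≤ 1) (hD0 : 0 < D) (hD : D ≤ gap U label lam Y Z)
    (hδ : 2 * (ε + τ) + ε ≤ D ^ 2 * lam / 20000) (hη : 2 * η ≤ D ^ 2 * lam / 20000)
    (hε : ε ≤ 1) (hlam_lt : lam + 2 * τ + τ ^ 2 < minInradius U label Y * (1 - ε))
    {C : Fin N → Fin N → ℝ} (hC : IsLassoSSCOutput (compressed Ψ Y Z) lam C) :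
    SubspaceDetection label C := by
  intro i
  constructor
  · intro hCi
    have hC0 := hC i
    rw [hCi] at hC0
    refine h.not_isLassoSolution_zero hlam0.le hε (hlam_lt.trans_le ?_) hC0
    exact mul_le_mul_of_nonneg_right (minInradius_le_clusterInradius U label Y (label i))
      (sub_nonneg.2 hε)
  · intro j hCij
    by_contra hij
    set S : Set (Fin N) := {j | label j = label i ∧ j ≠ i} with hS
    have hdual : IsDualDirection lam (compressed Ψ Y Z i) (fun j : S => compressed Ψ Y Z j) _ :=
      dualDirection_spec hlam0 _ (clusterWithout (compressed Ψ Y Z) label i)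
    refine hCij ((hC i).eq_zero_of_abs_inner_lt_one hlam0 (by simp [hS]) hdual
      (fun j hj hji => ?_) fun hj => hij hj.1.symm)
    refine h.abs_inner_dualDirection_lt_one hZ hlam0 hlam1 (fun hl => hj ⟨hl, hji⟩) hD0 ?_ hδ hη
    linarith [gap_le_clusterInradius_sub_incoherence U label lam Y Z (label i)]

end IsNoisyCompression

theorem exists_isLassoSSCOutput {n : ℕ} (X : Fin N → Vec n) (hlam : 0 < lam) :
    ∃ C, IsLassoSSCOutput X lam C := by
  choose C hC using fun i => exists_isSupportedLassoSolution X hlam i {i}ᶜ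
  exact ⟨C, fun i => isSupportedLassoSolution_compl_singleton.1 (hC i)⟩

end Clusters

end CompressedSSC

open CompressedSSC in
theorem mainTheorem2_general {d p N k : ℕ} {U : Fin k → Submodule ℝ (Vec d)}
    {label : Fin N → Fin k} {Y Z : Fin N → Vec d} {Ψ : Vec d →ₗ[ℝ] Vec p} {ε η lam : ℝ}
    (hYU : ∀ i, Y i ∈ U (label i)) (hY : ∀ i, ‖Y i‖ = 1) (hZ : ∀ i, ‖Z i‖ ≤ η)
    (hμρ : ∀ l, incoherence U label lam (Y + Z) l < clusterInradius U label Y l)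
    (hΨ : ∀ l l', NearlyPreservesInner Ψ ε (U l) (U l'))
    (hΨZ : ∀ i, ‖Ψ (Z i)‖ ^ 2 ≤ (1 + ε) * ‖Z i‖ ^ 2) (hlam0 : 0 < lam)
    (hlam : lam < minInradius U label Y * (1 - ε) - 6 * η)
    (hmax : max ε η ≤ 1 / 200000 * (gap U label lam Y Z ^ 2 * lam)) :
    LassoSSCDetects (compressed Ψ Y Z) label lam := by
  refine ⟨exists_isLassoSSCOutput _ hlam0, fun C hC i => ?_⟩
  have : Nonempty (Fin k) := ⟨label i⟩
  obtain ⟨hε, hη⟩ := max_le_iff.1 hmax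
  have hη0 : 0 ≤ η := (norm_nonneg _).trans (hZ i)
  have hgap0 := gap_pos hμρ
  have hgap1 : gap U label lam Y Z ≤ 1 := by
    linarith [gap_le_clusterInradius_sub_incoherence U label lam Y Z (label i),
      clusterInradius_le_one hYU hY i, incoherence_nonneg U label lam (Y + Z) (label i)]
  have hε0 : 0 ≤ ε := (hΨ _ _).nonneg (hYU i) (hY i)
  have hlam1 := lt_one_of_lt_minInradius_mul hYU hY i hε0 hη0 hlam
  have hgap_sq : gap U label lam Y Z ^ 2 * lam ≤ 1 :=
    mul_le_one₀ (pow_le_one₀ hgap0.le hgap1) hlam0.le hlam1.le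
  have hη_sq : η ^ 2 ≤ η / 2 := by nlinarith
  have hcompression : IsNoisyCompression Ψ U label Y Z ε (2 * η) :=
    { mem := hYU
      norm_eq_one := hY
      nearlyPreservesInner := hΨ
      norm_map_noise_le := fun i => by
        refine le_of_sq_le_sq ((hΨZ i).trans ?_) (by positivity)
        calc (1 + ε) * ‖Z i‖ ^ 2 ≤ 4 * η ^ 2 := by
              gcongr
              exacts [by linarith, hZ i]
          _ = (2 * η) ^ 2 := by ring }
  exact hcompression.subspaceDetection hZ hlam0 hlam1.le hgap0 le_rfl (by linarith) (by linarith)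
    (by linarith) (by linarith) hC i

open CompressedSSC in
theorem mainTheorem2 :
    ∃ c : ℝ, 0 < c ∧
      ∀ (d p N k : ℕ) (U : Fin k → Submodule ℝ (CompressedSSC.Vec d)) (label : Fin N → Fin k)
        (Y Z : Fin N → CompressedSSC.Vec d)
        (Ψ : CompressedSSC.Vec d →ₗ[ℝ] CompressedSSC.Vec p) (ε η lam : ℝ),
        (∀ i, Y i ∈ U (label i)) →
        (∀ i, ‖Y i‖ = 1) →
        (∀ i, ‖Z i‖ ≤ η) →
        (∀ l, CompressedSSC.incoherence U label lam (Y + Z) l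
          < CompressedSSC.clusterInradius U label Y l) →
        CompressedSSC.WellBehaved Ψ U (Y + Z) Z ε →
        24 * η / CompressedSSC.gap U label lam Y Z < lam →
        lam < CompressedSSC.minInradius U label Y * (1 - ε) - 6 * η →
        max ε η ≤ c * (CompressedSSC.gap U label lam Y Z ^ 2 * lam ^ (3 / 2 : ℝ)) →
        CompressedSSC.LassoSSCDetects (CompressedSSC.compressed Ψ Y Z) label lam := by
  refine ⟨1 / 200000, by norm_num,
    fun d p N k U label Y Z Ψ ε η lam hYU hY hZ hμρ hΨ hlow hhigh hmax => ?_⟩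
  rcases isEmpty_or_nonempty (Fin N) with hN | ⟨⟨i⟩⟩
  · exact ⟨⟨fun j => isEmptyElim j, fun j => isEmptyElim j⟩, fun _ _ j => isEmptyElim j⟩
  have : Nonempty (Fin k) := ⟨label i⟩
  have hη0 : 0 ≤ η := (norm_nonneg _).trans (hZ i)
  have hε0 : 0 ≤ ε := (hΨ.nearlyPreservesInner _ _).nonneg (hYU i) (hY i)
  have hlam0 : 0 < lam := hlow.trans_le' (div_nonneg (by positivity) (gap_pos hμρ).le)
  have hlam1 := lt_one_of_lt_minInradius_mul hYU hY i hε0 hη0 hhigh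
  have hrpow : lam ^ (3 / 2 : ℝ) ≤ lam := by
    simpa using Real.rpow_le_rpow_of_exponent_ge hlam0 hlam1.le (show (1 : ℝ) ≤ 3 / 2 by norm_num)
  exact mainTheorem2_general hYU hY hZ hμρ hΨ.nearlyPreservesInner
    (fun i => (hΨ.norm_noise i).2) hlam0 hhigh (hmax.trans (by gcongr))
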